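/- Let $\mathbf C^2_1$ be $\mathbb C^2$ with complex structure $J$ (multiplication by $\mathrm i$) and the metric $\langle z,w\rangle=\operatorname{Re}(-\bar z_1w_1+\bar z_2w_2)$. Let $L:M\to\mathbf C^2_1$ be a smooth immersion of a connected smooth surface whose induced metric is Lorentzian, and let $\theta\in\mathbb R$. Assume that $L$ is minimal (its mean curvature vector vanishes), flat (the curvature tensor of the induced metric vanishes) and $\theta$-slant: every tangent plane has a basis $e_1,e_2$ with $\langle e_1,e_1\rangle=\langle e_2,e_2\rangle=0$, $\langle e_1,e_2\rangle=-1$, $Pe_1=(\sinh\theta)\,e_1$, $Pe_2=-(\sinh\theta)\,e_2$, where $PX$ is the tangential component of $JX$. (The order of $e_1,e_2$ is not prescribed; exchanging them changes the sign of $\theta$.) A rigid motion is an affine bijection of $\mathbf C^2_1$ that preserves the metric and is holomorphic or anti-holomorphic. For open intervals $I,K\subset\mathbb R$, a null rectangle is a smooth map $\varphi:I\times K\to M$ that pulls the induced metric back to $-dx\otimes dy-dy\otimes dx$. Then one of the following holds. (a) $L(M)$ is an open piece of a (totally geodesic) real affine plane of $\mathbf C^2_1$ which is $\theta$-slant. (b)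 $L$ is not totally geodesic and is, on null rectangles, congruent to $$\psi(x,y)=\Big(x+\tfrac y2\cosh^2\theta+(\mathrm i-\sinh\theta)f(y),\; x-y+\tfrac y2\cosh^2\theta+(\mathrm i-\sinh\theta)f(y)-\mathrm i\,y\sinh\theta\Big)$$ in the following sense. Every point of $M$ lies in the image of an injective null rectangle $\varphi:I\times K\to M$ for which there are a smooth function $f:K\to\mathbb R$ and a rigid motion $\Phi$ with $L(\varphi(x,y))=\Phi(\psi(x,y))$ on $I\times K$. Moreover, for every null rectangle $\varphi:I\times K\to M$ there are a rigid motion $\Phi$ and either a smooth $f:K\to\mathbb R$ with $L(\varphi(x,y))=\Phi(\psi(x,y))$ on all of $I\times K$, or a smooth $f:I\to\mathbb R$ with $L(\varphi(x,y))=\Phi(\psi(y,x))$ on all of $I\times K$. -/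

import Mathlib

open scoped Manifold ContDiff

noncomputable section

namespace LorentzianC2

/-- The coordinate plane `ℝ²` in which the charts of a surface take their values. -/
abbrev E2 : Type := EuclideanSpace ℝ (Fin 2)

/-! ### The Lorentzian complex plane `ℂ²₁` -/

/-- The Hermitian form `b(z, w) = - z̄₁ w₁ + z̄₂ w₂` on `ℂ²`. -/
def herm (z w : ℂ × ℂ) : ℂ :=
  -(starRingEnd ℂ z.1 * w.1) + starRingEnd ℂ z.2 * w.2

/-- The metric `⟨z, w⟩ = Re b(z, w)` of `ℂ²₁`. -/
def metric (z w : ℂ × ℂ) : ℝ := (herm z w).re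

/-- The complex structure `J` of `ℂ²₁`, i.e. multiplication by the imaginary unit. -/
def cplxJ (z : ℂ × ℂ) : ℂ × ℂ := Complex.I • z

/-- A rigid motion of `ℂ²₁`: an affine bijection that preserves the metric and preserves
the complex structure up to sign (a holomorphic or anti-holomorphic isometry). -/
def IsMotion (Φ : (ℂ × ℂ) ≃ᵃ[ℝ] (ℂ × ℂ)) : Prop :=
  (∀ z w, metric (Φ.linear z) (Φ.linear w) = metric z w) ∧
    ((∀ z, Φ.linear (cplxJ z) = cplxJ (Φ.linear z)) ∨
      (∀ z, Φ.linear (cplxJ z) = -cplxJ (Φ.linear z)))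

/-! ### Lorentzian planes and their Wirtinger angle -/

/-- A real two-dimensional subspace on which the metric has signature `(1, 1)`. -/
def IsLorentzianPlane (W : Submodule ℝ (ℂ × ℂ)) : Prop :=
  Module.finrank ℝ W = 2 ∧ (∃ v ∈ W, metric v v < 0) ∧ ∃ v ∈ W, 0 < metric v v

/-- `v` is the component of `z` tangential to `W`: `v ∈ W` and `z - v ⊥ W`. -/
def IsTangentialPart (W : Submodule ℝ (ℂ × ℂ)) (z v : ℂ × ℂ) : Prop :=
  v ∈ W ∧ ∀ w ∈ W, metric (z - v) w = 0

/-- `W` is a Lorentzian plane with Wirtinger angle `θ`: it has a pseudo-orthonormal basis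
`e₁, e₂` such that `P e₁ = sinh θ e₁` and `P e₂ = - sinh θ e₂`, where `P v` is the tangential
part of `J v`. (Exchanging `e₁` and `e₂` changes the sign of `θ`.) -/
def IsSlantPlane (θ : ℝ) (W : Submodule ℝ (ℂ × ℂ)) : Prop :=
  IsLorentzianPlane W ∧ ∃ e₁ ∈ W, ∃ e₂ ∈ W,
    metric e₁ e₁ = 0 ∧ metric e₂ e₂ = 0 ∧ metric e₁ e₂ = -1 ∧
    IsTangentialPart W (cplxJ e₁) (Real.sinh θ • e₁) ∧
    IsTangentialPart W (cplxJ e₂) (-Real.sinh θ • e₂)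

/-! ### Local geometry of a parametrized surface `F : ℝ² → ℂ²₁` -/

/-- The partial derivative `∂ᵢ f`. -/
def pd {V : Type*} [NormedAddCommGroup V] [NormedSpace ℝ V]
    (i : Fin 2) (f : E2 → V) (u : E2) : V :=
  fderiv ℝ f u (EuclideanSpace.single i 1)

/-- The tangent plane at the parameter `u`. -/
def tangentPlane (F : E2 → ℂ × ℂ) (u : E2) : Submodule ℝ (ℂ × ℂ) :=
  LinearMap.range (fderiv ℝ F u : E2 →ₗ[ℝ] ℂ × ℂ)

/-- The matrix `g_ij = ⟨∂ᵢ F, ∂ⱼ F⟩` of the induced metric. -/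
def gram (F : E2 → ℂ × ℂ) (u : E2) : Matrix (Fin 2) (Fin 2) ℝ :=
  Matrix.of fun i j => metric (pd i F u) (pd j F u)

/-- The Christoffel symbols `Γᵏᵢⱼ` of the Levi-Civita connection of the induced metric. -/
def christoffel (F : E2 → ℂ × ℂ) (k i j : Fin 2) (u : E2) : ℝ :=
  1 / 2 * ∑ l, (gram F u)⁻¹ k l *
    (pd i (fun v => gram F v j l) u + pd j (fun v => gram F v i l) u
      - pd l (fun v => gram F v i j) u)

/-- The components `Rˡ_{kij}` of the curvature tensor of the induced metric:
`R(∂ᵢ, ∂ⱼ) ∂ₖ = ∑ₗ Rˡ_{kij} ∂ₗ`. -/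
def curvature (F : E2 → ℂ × ℂ) (l k i j : Fin 2) (u : E2) : ℝ :=
  pd i (christoffel F l j k) u - pd j (christoffel F l i k) u
    + ∑ m, (christoffel F l i m u * christoffel F m j k u
      - christoffel F l j m u * christoffel F m i k u)

/-- The second fundamental form `h(∂ᵢ, ∂ⱼ) = ∂ᵢ∂ⱼ F - ∑ₖ Γᵏᵢⱼ ∂ₖ F` (formula of Gauss). -/
def secondForm (F : E2 → ℂ × ℂ) (i j : Fin 2) (u : E2) : ℂ × ℂ :=
  pd i (pd j F) u - ∑ k, christoffel F k i j u • pd k F u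

/-- The mean curvature vector `H = ½ trace h`. -/
def meanCurvature (F : E2 → ℂ × ℂ) (u : E2) : ℂ × ℂ :=
  (1 / 2 : ℝ) • ∑ i, ∑ j, (gram F u)⁻¹ i j • secondForm F i j u

/-! ### Surfaces in `ℂ²₁`

`M` is a smooth surface and `L : M → ℂ²₁`. Geometric quantities are computed in the charts `e` of
the atlas, that is for the parametrized surfaces `L ∘ e⁻¹`. -/

section Surfaces

variable {M : Type*} [TopologicalSpace M] [ChartedSpace E2 M]

/-- A property of parametrized surfaces at a parameter point holds everywhere on the surface `L`,
in all charts of the atlas. -/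
def InCharts (L : M → ℂ × ℂ) (Q : (E2 → ℂ × ℂ) → E2 → Prop) : Prop :=
  ∀ e ∈ atlas E2 M, ∀ u ∈ e.target, Q (L ∘ e.symm) u

/-- `L` is a smooth immersion whose induced metric is Lorentzian. -/
structure IsLorentzianSurface (L : M → ℂ × ℂ) : Prop where
  smooth : ContMDiff (𝓡 2) 𝓘(ℝ, ℂ × ℂ) ∞ L
  lorentzian : InCharts L fun F u => IsLorentzianPlane (tangentPlane F u)

/-- The mean curvature vector vanishes identically. -/
def IsMinimal (L : M → ℂ × ℂ) : Prop :=
  InCharts L fun F u => meanCurvature F u = 0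

/-- The curvature tensor of the induced metric vanishes identically. -/
def IsFlat (L : M → ℂ × ℂ) : Prop :=
  InCharts L fun F u => ∀ l k i j, curvature F l k i j u = 0

/-- The Wirtinger angle is the constant `θ`. -/
def IsSlant (θ : ℝ) (L : M → ℂ × ℂ) : Prop :=
  InCharts L fun F u => IsSlantPlane θ (tangentPlane F u)

/-- The second fundamental form vanishes identically. -/
def IsTotallyGeodesic (L : M → ℂ × ℂ) : Prop :=
  InCharts L fun F u => ∀ i j, secondForm F i j u = 0

/-- The image of `L` is an open piece of an affine real plane of `ℂ²₁` (a totally geodesic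
surface) whose Wirtinger angle is `θ`. -/
def IsOpenPieceOfSlantPlane (θ : ℝ) (L : M → ℂ × ℂ) : Prop :=
  ∃ A : AffineSubspace ℝ (ℂ × ℂ), IsSlantPlane θ A.direction ∧
    ∃ O : Set (ℂ × ℂ), IsOpen O ∧ Set.range L = (A : Set (ℂ × ℂ)) ∩ O

/-- `φ` is a local isometry into `M` (with the metric induced by `L`) from the rectangle `I × K`
of the Lorentzian plane with metric `- dx ⊗ dy - dy ⊗ dx`, for open intervals `I` and `K`. -/
structure IsNullRectangle (L : M → ℂ × ℂ) (I K : Set ℝ) (φ : ℝ × ℝ → M) : Prop where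
  open_left : IsOpen I
  interval_left : I.OrdConnected
  open_right : IsOpen K
  interval_right : K.OrdConnected
  smooth : ContMDiffOn 𝓘(ℝ, ℝ × ℝ) (𝓡 2) ∞ φ (I ×ˢ K)
  isometric : ∀ q ∈ I ×ˢ K, ∀ v w : ℝ × ℝ,
    metric (fderiv ℝ (L ∘ φ) q v) (fderiv ℝ (L ∘ φ) q w) = -(v.1 * w.2) - v.2 * w.1

end Surfaces

/-! ### The explicit surfaces -/

/-- The surface `ψ(x, y)` with angle `θ` and function `f(y)`. -/
def model (θ : ℝ) (f : ℝ → ℝ) (q : ℝ × ℝ) : ℂ × ℂ :=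
  let x := q.1
  let y := q.2
  ((x : ℂ) + y / 2 * (Real.cosh θ : ℂ) ^ 2 + (Complex.I - (Real.sinh θ : ℂ)) * (f y : ℂ),
    (x : ℂ) - y + y / 2 * (Real.cosh θ : ℂ) ^ 2 + (Complex.I - (Real.sinh θ : ℂ)) * (f y : ℂ)
      - Complex.I * y * (Real.sinh θ : ℂ))

/-- On `I × K` the parametrized surface `F` agrees, up to a rigid motion of `ℂ²₁`, with the explicit
surface for `θ` and some smooth function `f` on `K`. -/
def CongruentToModel (θ : ℝ) (F : ℝ × ℝ → ℂ × ℂ) (I K : Set ℝ) : Prop :=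
  ∃ f : ℝ → ℝ, ContDiffOn ℝ ∞ f K ∧
    ∃ Φ : (ℂ × ℂ) ≃ᵃ[ℝ] (ℂ × ℂ), IsMotion Φ ∧
      ∀ q ∈ I ×ˢ K, F q = Φ (model θ f q)

end LorentzianC2

end

/-!
In a flat Lorentzian surface a null frame can be rescaled to a parallel one, whose dual forms are
closed; their primitives are local coordinates `(x, y)` in which the induced metric is
`-dx ⊗ dy - dy ⊗ dx`. In such coordinates the second derivatives of `L` are normal, and
`∂ₓ∂ᵧL` is the mean curvature vector up to sign. Minimality therefore makes `∂ₓL` a function of `x`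
alone and `∂ᵧL` a function of `y` alone, and the slant condition makes the complex number
`b(∂ₓL, ∂ᵧL) = -1 ± i sinh θ` constant. If `∂ₓL` takes two different values, all values of `∂ᵧL`
are orthogonal to their difference, hence complex proportional, hence equal. So one of the two
derivatives is constant, say `∂ₓL = a`, and `L = x a + γ(y)`. A rigid motion takes `a` to `(1, 1)`,
and then `γ'` is a null vector with prescribed Hermitian product with `(1, 1)`; such vectors form
a real affine line, and the position of `γ'` on it is the derivative of the function `f`.

In the totally geodesic case `L` is affine in these coordinates, so its affine tangent plane is
locally constant, and constant because `M` is connected.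
-/

namespace LorentzianC2

theorem metric_eq_re_im (z w : ℂ × ℂ) :
    metric z w = -(z.1.re * w.1.re + z.1.im * w.1.im) + (z.2.re * w.2.re + z.2.im * w.2.im) := by
  simp [metric, herm]

theorem metric_comm (z w : ℂ × ℂ) : metric z w = metric w z := by
  simp only [metric_eq_re_im]
  ring

theorem metric_add_left (z z' w : ℂ × ℂ) : metric (z + z') w = metric z w + metric z' w := by
  simp only [metric_eq_re_im, Prod.fst_add, Prod.snd_add, Complex.add_re, Complex.add_im]
  ring

theorem metric_smul_left (c : ℝ) (z w : ℂ × ℂ) : metric (c • z) w = c * metric z w := by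
  simp only [metric_eq_re_im, Prod.smul_fst, Prod.smul_snd, Complex.smul_re, Complex.smul_im,
    smul_eq_mul]
  ring

theorem metric_add_right (z w w' : ℂ × ℂ) : metric z (w + w') = metric z w + metric z w' := by
  rw [metric_comm, metric_add_left, metric_comm w, metric_comm w']

theorem metric_smul_right (c : ℝ) (z w : ℂ × ℂ) : metric z (c • w) = c * metric z w := by
  rw [metric_comm, metric_smul_left, metric_comm w]

/-- The metric of `ℂ²₁` as a continuous bilinear form, to which the rules for bilinear maps
apply. -/
noncomputable def metricForm : (ℂ × ℂ) →L[ℝ] (ℂ × ℂ) →L[ℝ] ℝ :=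
  (LinearMap.mk₂ ℝ metric metric_add_left metric_smul_left metric_add_right
    metric_smul_right).toContinuousBilinearMap

theorem metricForm_apply (z w : ℂ × ℂ) : metricForm z w = metric z w := rfl

theorem metric_sub_left (z z' w : ℂ × ℂ) : metric (z - z') w = metric z w - metric z' w := by
  simp only [← metricForm_apply, map_sub, sub_apply]

theorem metric_neg_left (z w : ℂ × ℂ) : metric (-z) w = -metric z w := by
  simp only [← metricForm_apply, map_neg, neg_apply]

theorem metric_zero_left (w : ℂ × ℂ) : metric 0 w = 0 := by
  simp only [← metricForm_apply, map_zero, zero_apply]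

theorem metric_sum_left {ι : Type*} (s : Finset ι) (f : ι → ℂ × ℂ) (w : ℂ × ℂ) :
    metric (∑ i ∈ s, f i) w = ∑ i ∈ s, metric (f i) w := by
  simp only [← metricForm_apply, map_sum, sum_apply]

section Calculus

variable {E V : Type*} [NormedAddCommGroup E] [NormedSpace ℝ E]
  [NormedAddCommGroup V] [NormedSpace ℝ V] {U : Set E} {u : E}

theorem differentiableAt_of_contDiffOn {f : E → V} (hf : ContDiffOn ℝ ∞ f U) (hU : IsOpen U)
    (hu : u ∈ U) : DifferentiableAt ℝ f u :=
  (hf.contDiffAt (hU.mem_nhds hu)).differentiableAt (by simp)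

theorem contDiffOn_fderiv {f : E → V} (hf : ContDiffOn ℝ ∞ f U) (hU : IsOpen U) :
    ContDiffOn ℝ ∞ (fderiv ℝ f) U :=
  hf.fderiv_of_isOpen hU (by simp)

theorem differentiableAt_fderiv {f : E → V} (hf : ContDiffOn ℝ ∞ f U) (hU : IsOpen U) (hu : u ∈ U) :
    DifferentiableAt ℝ (fderiv ℝ f) u :=
  differentiableAt_of_contDiffOn (contDiffOn_fderiv hf hU) hU hu

theorem fderiv_fderiv_comm {f : E → V} (hf : ContDiffOn ℝ ∞ f U) (hU : IsOpen U) (hu : u ∈ U)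
    (v w : E) :
    fderiv ℝ (fderiv ℝ f) u v w = fderiv ℝ (fderiv ℝ f) u w v :=
  (hf.contDiffAt (hU.mem_nhds hu)).isSymmSndFDerivAt
    (by simpa using WithTop.coe_le_coe.2 (le_top (a := (2 : ℕ∞)))) v w

theorem fderiv_fderiv_apply {f : E → V} {X : E → E} (hf : DifferentiableAt ℝ (fderiv ℝ f) u)
    (hX : DifferentiableAt ℝ X u) (v : E) :
    fderiv ℝ (fun u => fderiv ℝ f u (X u)) u v =
      fderiv ℝ (fderiv ℝ f) u v (X u) + fderiv ℝ f u (fderiv ℝ X u v) := by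
  rw [fderiv_clm_apply hf hX]
  simp [add_comm]

theorem fderiv_fun_smul_apply {V : Type*} [NormedAddCommGroup V] [NormedSpace ℝ V]
    {c : E → ℝ} {f : E → V} (hc : DifferentiableAt ℝ c u)
    (hf : DifferentiableAt ℝ f u) (v : E) :
    fderiv ℝ (fun u => c u • f u) u v = fderiv ℝ c u v • f u + c u • fderiv ℝ f u v := by
  rw [fderiv_fun_smul hc hf]
  simp [add_comm]

theorem contDiffOn_metric {f g : E → ℂ × ℂ} (hf : ContDiffOn ℝ ∞ f U)
    (hg : ContDiffOn ℝ ∞ g U) : ContDiffOn ℝ ∞ (fun u => metric (f u) (g u)) U :=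
  metricForm.isBoundedBilinearMap.contDiff.comp_contDiffOn (hf.prodMk hg)

theorem fderiv_metric {f g : E → ℂ × ℂ} (hf : DifferentiableAt ℝ f u)
    (hg : DifferentiableAt ℝ g u) (v : E) :
    fderiv ℝ (fun u => metric (f u) (g u)) u v =
      metric (fderiv ℝ f u v) (g u) + metric (f u) (fderiv ℝ g u v) := by
  rw [show fderiv ℝ (fun u => metric (f u) (g u)) u = _ from
    metricForm.fderiv_of_bilinear hf hg]
  simp [metricForm_apply, add_comm]

theorem metric_fderiv_fderiv_eq_zero {G : E → ℂ × ℂ} (hG : ContDiffOn ℝ ∞ G U) (hU : IsOpen U)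
    {c : E → E → ℝ} (hc : ∀ u ∈ U, ∀ v w, metric (fderiv ℝ G u v) (fderiv ℝ G u w) = c v w)
    (hu : u ∈ U) (v w z : E) :
    metric (fderiv ℝ (fderiv ℝ G) u v w) (fderiv ℝ G u z) = 0 := by
  have hd := differentiableAt_fderiv hG hU hu
  have hskew : ∀ v w z : E, metric (fderiv ℝ (fderiv ℝ G) u v w) (fderiv ℝ G u z) +
      metric (fderiv ℝ (fderiv ℝ G) u v z) (fderiv ℝ G u w) = 0 := by
    intro v w z
    have hconst : fderiv ℝ (fun u => metric (fderiv ℝ G u w) (fderiv ℝ G u z)) u v = 0 := by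
      have : (fun u => metric (fderiv ℝ G u w) (fderiv ℝ G u z)) =ᶠ[nhds u] fun _ => c w z := by
        filter_upwards [hU.mem_nhds hu] with x hx using hc x hx w z
      simp [this.fderiv_eq]
    have happly : ∀ w, fderiv ℝ (fun u => fderiv ℝ G u w) u v = fderiv ℝ (fderiv ℝ G) u v w :=
      fun w => by simp [fderiv_fderiv_apply (X := fun _ => w) hd (differentiableAt_const w)]
    rw [fderiv_metric (hd.clm_apply (differentiableAt_const w))
      (hd.clm_apply (differentiableAt_const z)), happly, happly] at hconst
    rwa [metric_comm (fderiv ℝ G u w)] at hconst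
  -- a trilinear form symmetric in one pair of slots and skew in another one vanishes
  linarith [hskew v w z, hskew w z v, hskew z v w,
    congrArg (metric · (fderiv ℝ G u w)) (fderiv_fderiv_comm hG hU hu v z),
    congrArg (metric · (fderiv ℝ G u v)) (fderiv_fderiv_comm hG hU hu w z),
    congrArg (metric · (fderiv ℝ G u z)) (fderiv_fderiv_comm hG hU hu v w)]

theorem exists_primitive {η : E → E →L[ℝ] ℝ} (hU : IsOpen U) (hconv : Convex ℝ U)
    (hη : ContDiffOn ℝ ∞ η U) (hclosed : ∀ u ∈ U, ∀ v w, fderiv ℝ η u v w = fderiv ℝ η u w v) :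
    ∃ f : E → ℝ, ContDiffOn ℝ ∞ f U ∧ ∀ u ∈ U, fderiv ℝ f u = η u := by
  obtain ⟨f, hf⟩ := hconv.exists_forall_hasFDerivAt_of_fderiv_symmetric hU
    (hη.differentiableOn (by simp)) hclosed
  refine ⟨f, (contDiffOn_infty_iff_fderiv_of_isOpen hU).2
    ⟨fun u hu => (hf u hu).differentiableAt.differentiableWithinAt, ?_⟩,
    fun u hu => (hf u hu).fderiv⟩
  exact hη.congr fun u hu => (hf u hu).fderiv

theorem exists_primitive_metric_fderiv {A B : E → ℂ × ℂ} (hU : IsOpen U) (hconv : Convex ℝ U)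
    (hA : ContDiffOn ℝ ∞ A U) (hB : ContDiffOn ℝ ∞ B U)
    (hsymm : ∀ u ∈ U, ∀ v w,
      metric (fderiv ℝ B u v) (fderiv ℝ A u w) = metric (fderiv ℝ B u w) (fderiv ℝ A u v)) :
    ∃ f : E → ℝ, ContDiffOn ℝ ∞ f U ∧
      ∀ u ∈ U, ∀ v, fderiv ℝ f u v = metric (B u) (fderiv ℝ A u v) := by
  set η : E → E →L[ℝ] ℝ := fun u => (metricForm (B u)).comp (fderiv ℝ A u)
  have hη : ContDiffOn ℝ ∞ η U :=
    (metricForm.contDiff.comp_contDiffOn hB).clm_comp (contDiffOn_fderiv hA hU)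
  have hdη : ∀ u ∈ U, ∀ v w, fderiv ℝ η u v w =
      metric (B u) (fderiv ℝ (fderiv ℝ A) u v w) + metric (fderiv ℝ B u v) (fderiv ℝ A u w) := by
    intro u hu v w
    have hdB := metricForm.hasFDerivAt.comp u (differentiableAt_of_contDiffOn hB hU hu).hasFDerivAt
    rw [show fderiv ℝ η u = _ from
      (hdB.clm_comp (differentiableAt_fderiv hA hU hu).hasFDerivAt).fderiv]
    simp [metricForm_apply]
  obtain ⟨f, hf, hdf⟩ := exists_primitive hU hconv hη fun u hu v w => by
    rw [hdη u hu, hdη u hu, fderiv_fderiv_comm hA hU hu, hsymm u hu]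
  exact ⟨f, hf, fun u hu v => by rw [hdf u hu]; rfl⟩

theorem eq_of_fderiv_sub_eq_zero {f : E → V} {s : Set E} {q q' : E} (hs : Convex ℝ s)
    (hf : ∀ x ∈ s, DifferentiableAt ℝ f x) (hq : q ∈ s) (hq' : q' ∈ s)
    (hzero : ∀ x ∈ s, fderiv ℝ f x (q' - q) = 0) : f q = f q' := by
  have hmem : ∀ t ∈ Set.Icc (0 : ℝ) 1, AffineMap.lineMap q q' t ∈ s := fun t ht =>
    hs.segment_subset hq hq' (segment_eq_image_lineMap ℝ q q' ▸ Set.mem_image_of_mem _ ht)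
  have hderiv : ∀ t ∈ Set.Icc (0 : ℝ) 1,
      HasDerivAt (f ∘ AffineMap.lineMap q q') (0 : V) t := fun t ht => by
    rw [← hzero _ (hmem t ht)]
    exact (hf _ (hmem t ht)).hasFDerivAt.comp_hasDerivAt t AffineMap.hasDerivAt_lineMap
  have hconst := constant_of_has_deriv_right_zero
    (fun t ht => (hderiv t ht).continuousAt.continuousWithinAt)
    (fun t ht => (hderiv t (Set.Ico_subset_Icc_self ht)).hasDerivWithinAt) 1 (by simp)
  simpa using hconst.symm

end Calculus

theorem metric_cplxJ_left (z w : ℂ × ℂ) : metric (cplxJ z) w = -metric (cplxJ w) z := by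
  simp only [cplxJ, metric_eq_re_im, Prod.smul_fst, Prod.smul_snd, smul_eq_mul, Complex.mul_re,
    Complex.mul_im, Complex.I_re, Complex.I_im]
  ring

theorem metric_cplxJ_self (z : ℂ × ℂ) : metric (cplxJ z) z = 0 := by
  linarith [metric_cplxJ_left z z]

/-- A pseudo-orthonormal pair: two null vectors of `ℂ²₁` normalized by `⟨e₁, e₂⟩ = -1`. -/
structure IsNullPair (e₁ e₂ : ℂ × ℂ) : Prop where
  left : metric e₁ e₁ = 0
  right : metric e₂ e₂ = 0
  cross : metric e₁ e₂ = -1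

namespace IsNullPair

variable {e₁ e₂ : ℂ × ℂ}

theorem symm (h : IsNullPair e₁ e₂) : IsNullPair e₂ e₁ :=
  ⟨h.right, h.left, by rw [metric_comm, h.cross]⟩

theorem smul_smul (h : IsNullPair e₁ e₂) {c d : ℝ} (hcd : c * d = 1) :
    IsNullPair (c • e₁) (d • e₂) := by
  constructor <;>
    simp [metric_smul_left, metric_smul_right, h.left, h.right, h.cross, hcd, mul_comm d c]

theorem linearIndependent (h : IsNullPair e₁ e₂) : LinearIndependent ℝ ![e₁, e₂] := by
  rw [LinearIndependent.pair_iff]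
  intro s t hst
  have h₁ : metric (s • e₁ + t • e₂) e₁ = 0 := by rw [hst, metric_zero_left]
  have h₂ : metric (s • e₁ + t • e₂) e₂ = 0 := by rw [hst, metric_zero_left]
  rw [metric_add_left, metric_smul_left, metric_smul_left] at h₁ h₂
  rw [h.left, metric_comm e₂ e₁, h.cross] at h₁
  rw [h.right, h.cross] at h₂
  constructor <;> linarith

section Plane

variable {E : Type*} [AddCommGroup E] [Module ℝ E] {T : E →ₗ[ℝ] ℂ × ℂ} {X Y : E}

theorem eq_smul_add_smul (h : IsNullPair (T X) (T Y)) (hE : Module.finrank ℝ E = 2) (Z : E) :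
    Z = -metric (T Z) (T Y) • X + -metric (T Z) (T X) • Y := by
  have : FiniteDimensional ℝ E := Module.finite_of_finrank_pos (by simp [hE])
  have hcomp : T ∘ ![X, Y] = ![T X, T Y] := by
    ext1 i
    fin_cases i <;> rfl
  have hind : LinearIndependent ℝ ![X, Y] := .of_comp T (hcomp ▸ h.linearIndependent)
  have hspan := hind.span_eq_top_of_card_eq_finrank' (by simp [hE])
  have hZ : Z ∈ Submodule.span ℝ {X, Y} := by
    rw [← Matrix.range_cons_cons_empty X Y ![], hspan]
    trivial
  obtain ⟨a, b, rfl⟩ := Submodule.mem_span_pair.1 hZ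
  simp only [map_add, map_smul, metric_add_left, metric_smul_left, h.left, h.right, h.cross,
    metric_comm (T Y) (T X)]
  congr 2 <;> ring

theorem injective (h : IsNullPair (T X) (T Y)) (hE : Module.finrank ℝ E = 2) :
    Function.Injective T := by
  rw [← LinearMap.ker_eq_bot, LinearMap.ker_eq_bot']
  intro Z hZ
  rw [h.eq_smul_add_smul hE Z]
  simp [hZ, metric_zero_left]

end Plane

end IsNullPair

theorem IsSlantPlane.metric_cplxJ_sq {θ : ℝ} {W : Submodule ℝ (ℂ × ℂ)} {X Y : ℂ × ℂ}
    (hW : IsSlantPlane θ W) (hX : X ∈ W) (hY : Y ∈ W) (h : IsNullPair X Y) :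
    metric (cplxJ X) Y ^ 2 = Real.sinh θ ^ 2 := by
  obtain ⟨⟨hdim, -⟩, e₁, he₁, e₂, he₂, h₁₁, h₂₂, h₁₂, ⟨-, hJ⟩, -⟩ := hW
  have he : IsNullPair e₁ e₂ := ⟨h₁₁, h₂₂, h₁₂⟩
  have hJe : metric (cplxJ e₁) e₂ = -Real.sinh θ := by
    have := hJ e₂ he₂
    rw [metric_sub_left, metric_smul_left, h₁₂] at this
    linarith
  have hdecomp : ∀ Z ∈ W, ∃ a b : ℝ, Z = a • e₁ + b • e₂ := fun Z hZ => ⟨_, _, congrArg Subtype.val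
    (he.eq_smul_add_smul (T := W.subtype) (X := ⟨e₁, he₁⟩) (Y := ⟨e₂, he₂⟩) hdim ⟨Z, hZ⟩)⟩
  obtain ⟨a, b, rfl⟩ := hdecomp X hX
  obtain ⟨c, d, rfl⟩ := hdecomp Y hY
  obtain ⟨hX, hY, hXY⟩ := h
  simp only [metric_add_left, metric_add_right, metric_smul_left, metric_smul_right, h₁₁, h₂₂,
    h₁₂, metric_comm e₂ e₁] at hX hY hXY
  have hab : a * b = 0 := by linarith
  have hdet : a * d + b * c = 1 := by linarith
  have hmetric : metric (cplxJ (a • e₁ + b • e₂)) (c • e₁ + d • e₂) =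
      -((a * d - b * c) * Real.sinh θ) := by
    have hJ_add : cplxJ (a • e₁ + b • e₂) = a • cplxJ e₁ + b • cplxJ e₂ := by
      simp only [cplxJ, smul_add, smul_comm Complex.I]
    rw [hJ_add]
    simp only [metric_add_left, metric_add_right, metric_smul_left, metric_smul_right,
      metric_cplxJ_self, metric_cplxJ_left e₂ e₁, hJe]
    ring
  have hsq : (a * d - b * c) ^ 2 = 1 := by
    linear_combination (a * d + b * c + 1) * hdet - 4 * c * d * hab
  rw [hmetric]
  linear_combination Real.sinh θ ^ 2 * hsq

/-! ### The equations of Gauss -/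

section Gauss

variable {F : E2 → ℂ × ℂ} {U : Set E2} {u : E2}

theorem eq_sum_smul_single (v : E2) : v = ∑ i, v i • EuclideanSpace.single i (1 : ℝ) := by
  ext i
  fin_cases i <;> simp

theorem fderiv_apply_eq_sum_pd {V : Type*} [NormedAddCommGroup V] [NormedSpace ℝ V] (f : E2 → V)
    (u v : E2) : fderiv ℝ f u v = ∑ i, v i • pd i f u := by
  conv_lhs => rw [eq_sum_smul_single v, map_sum]
  simp only [map_smul, pd]

theorem pd_pd_eq_fderiv_fderiv {V : Type*} [NormedAddCommGroup V] [NormedSpace ℝ V] {f : E2 → V}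
    (hf : DifferentiableAt ℝ (fderiv ℝ f) u) (i j : Fin 2) :
    pd i (pd j f) u =
      fderiv ℝ (fderiv ℝ f) u (EuclideanSpace.single i 1) (EuclideanSpace.single j 1) :=
  (fderiv_fderiv_apply hf (differentiableAt_const _) _).trans (by simp)

theorem pd_comm {V : Type*} [NormedAddCommGroup V] [NormedSpace ℝ V] {f : E2 → V}
    (hf : ContDiffOn ℝ ∞ f U) (hU : IsOpen U) (hu : u ∈ U) (i j : Fin 2) :
    pd i (pd j f) u = pd j (pd i f) u := by
  have hd := differentiableAt_fderiv hf hU hu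
  rw [pd_pd_eq_fderiv_fderiv hd, pd_pd_eq_fderiv_fderiv hd, fderiv_fderiv_comm hf hU hu]

theorem contDiffOn_pd {V : Type*} [NormedAddCommGroup V] [NormedSpace ℝ V] {f : E2 → V}
    (hf : ContDiffOn ℝ ∞ f U) (hU : IsOpen U) (i : Fin 2) : ContDiffOn ℝ ∞ (pd i f) U :=
  (contDiffOn_fderiv hf hU).clm_apply contDiffOn_const

theorem gram_apply (F : E2 → ℂ × ℂ) (u : E2) (i j : Fin 2) :
    gram F u i j = metric (pd i F u) (pd j F u) := rfl

theorem gram_comm (F : E2 → ℂ × ℂ) (u : E2) (i j : Fin 2) : gram F u i j = gram F u j i :=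
  metric_comm _ _

theorem contDiffOn_gram (hF : ContDiffOn ℝ ∞ F U) (hU : IsOpen U) (i j : Fin 2) :
    ContDiffOn ℝ ∞ (fun u => gram F u i j) U :=
  contDiffOn_metric (contDiffOn_pd hF hU i) (contDiffOn_pd hF hU j)

theorem contDiffOn_gram_inv (hF : ContDiffOn ℝ ∞ F U) (hU : IsOpen U)
    (hdet : ∀ u ∈ U, (gram F u).det ≠ 0) (i j : Fin 2) :
    ContDiffOn ℝ ∞ (fun u => (gram F u)⁻¹ i j) U := by
  have h := contDiffOn_gram hF hU
  have hinv : ContDiffOn ℝ ∞ (fun u => (gram F u).det⁻¹) U := by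
    refine ContDiffOn.inv ?_ hdet
    simp only [Matrix.det_fin_two]
    exact ((h 0 0).mul (h 1 1)).sub ((h 0 1).mul (h 1 0))
  simp only [Matrix.inv_def, Ring.inverse_eq_inv', Matrix.smul_apply, smul_eq_mul,
    Matrix.adjugate_fin_two]
  fin_cases i <;> fin_cases j
  exacts [hinv.mul (h 1 1), hinv.mul (h 0 1).neg, hinv.mul (h 1 0).neg, hinv.mul (h 0 0)]

theorem contDiffOn_christoffel (hF : ContDiffOn ℝ ∞ F U) (hU : IsOpen U)
    (hdet : ∀ u ∈ U, (gram F u).det ≠ 0) (k i j : Fin 2) :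
    ContDiffOn ℝ ∞ (christoffel F k i j) U :=
  have hpd := fun i j l => contDiffOn_pd (contDiffOn_gram hF hU i j) hU l
  contDiffOn_const.mul <| ContDiffOn.sum fun l _ => (contDiffOn_gram_inv hF hU hdet k l).mul
    (((hpd j l i).add (hpd i l j)).sub (hpd i j l))

theorem contDiffOn_secondForm (hF : ContDiffOn ℝ ∞ F U) (hU : IsOpen U)
    (hdet : ∀ u ∈ U, (gram F u).det ≠ 0) (i j : Fin 2) :
    ContDiffOn ℝ ∞ (secondForm F i j) U :=
  (contDiffOn_pd (contDiffOn_pd hF hU j) hU i).sub (ContDiffOn.sum fun k _ =>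
    (contDiffOn_christoffel hF hU hdet k i j).smul (contDiffOn_pd hF hU k))

theorem secondForm_comm (hF : ContDiffOn ℝ ∞ F U) (hU : IsOpen U) (hu : u ∈ U) (i j : Fin 2) :
    secondForm F i j u = secondForm F j i u := by
  simp only [secondForm, christoffel, pd_comm hF hU hu i j, add_comm (pd i _ u), gram_comm F _ i j]

theorem christoffel_eq_mulVec (hF : ContDiffOn ℝ ∞ F U) (hU : IsOpen U) (hu : u ∈ U)
    (k i j : Fin 2) :
    christoffel F k i j u =
      ((gram F u)⁻¹.mulVec fun l => metric (pd i (pd j F) u) (pd l F u)) k := by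
  have hd := fun i => differentiableAt_of_contDiffOn (contDiffOn_pd hF hU i) hU hu
  have hpd : ∀ i j l, pd i (fun v => gram F v j l) u =
      metric (pd i (pd j F) u) (pd l F u) + metric (pd i (pd l F) u) (pd j F u) := fun i j l => by
    rw [metric_comm (pd i (pd l F) u)]
    exact fderiv_metric (hd j) (hd l) _
  simp only [christoffel, Matrix.mulVec, dotProduct, Finset.mul_sum]
  refine Finset.sum_congr rfl fun l _ => ?_
  rw [hpd, hpd, hpd, pd_comm hF hU hu j i, pd_comm hF hU hu l i, pd_comm hF hU hu l j]
  ring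

theorem sum_christoffel_gram (hF : ContDiffOn ℝ ∞ F U) (hU : IsOpen U) (hu : u ∈ U)
    (hdet : (gram F u).det ≠ 0) (i j l : Fin 2) :
    ∑ k, christoffel F k i j u * gram F u k l = metric (pd i (pd j F) u) (pd l F u) := by
  set c : Fin 2 → ℝ := fun l => metric (pd i (pd j F) u) (pd l F u)
  have hinv : (gram F u).mulVec ((gram F u)⁻¹.mulVec c) = c := by
    rw [Matrix.mulVec_mulVec, Matrix.mul_nonsing_inv _ (isUnit_iff_ne_zero.2 hdet),
      Matrix.one_mulVec]
  calc ∑ k, christoffel F k i j u * gram F u k l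
      = ∑ k, gram F u l k * (gram F u)⁻¹.mulVec c k :=
        Finset.sum_congr rfl fun k _ => by
          rw [christoffel_eq_mulVec hF hU hu, gram_comm, mul_comm]
    _ = c l := congrFun hinv l

theorem metric_secondForm_pd (hF : ContDiffOn ℝ ∞ F U) (hU : IsOpen U) (hu : u ∈ U)
    (hdet : (gram F u).det ≠ 0) (i j l : Fin 2) :
    metric (secondForm F i j u) (pd l F u) = 0 := by
  simp only [secondForm, metric_sub_left, metric_sum_left, metric_smul_left, ← gram_apply]
  rw [sum_christoffel_gram hF hU hu hdet, sub_self]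

theorem metric_pd_secondForm (hF : ContDiffOn ℝ ∞ F U) (hU : IsOpen U)
    (hdet : ∀ u ∈ U, (gram F u).det ≠ 0) (hu : u ∈ U) (i j k l : Fin 2) :
    metric (pd i (secondForm F j k) u) (pd l F u) =
      -metric (secondForm F j k u) (secondForm F i l u) := by
  have hnormal : pd i (fun u => metric (secondForm F j k u) (pd l F u)) u = 0 := by
    have : (fun u => metric (secondForm F j k u) (pd l F u)) =ᶠ[nhds u] fun _ => 0 := by
      filter_upwards [hU.mem_nhds hu] with x hx
        using metric_secondForm_pd hF hU hx (hdet x hx) j k l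
    rw [pd, this.fderiv_eq]
    simp
  rw [pd, fderiv_metric
    (differentiableAt_of_contDiffOn (contDiffOn_secondForm hF hU hdet j k) hU hu)
    (differentiableAt_of_contDiffOn (contDiffOn_pd hF hU l) hU hu)] at hnormal
  have hpd : pd i (pd l F) u =
      (∑ m, christoffel F m i l u • pd m F u) + secondForm F i l u := by simp [secondForm]
  change metric (pd i _ u) _ + metric _ (pd i (pd l F) u) = 0 at hnormal
  rw [hpd, metric_comm, metric_comm (secondForm F j k u)] at hnormal
  simp only [metric_add_left, metric_sum_left, metric_smul_left, metric_comm (pd _ F u),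
    metric_secondForm_pd hF hU hu (hdet u hu), mul_zero, Finset.sum_const_zero] at hnormal
  rw [metric_comm (secondForm F j k u)]
  linarith

theorem pd_secondForm (hF : ContDiffOn ℝ ∞ F U) (hU : IsOpen U)
    (hdet : ∀ u ∈ U, (gram F u).det ≠ 0) (hu : u ∈ U) (i j k : Fin 2) :
    pd i (secondForm F j k) u = pd i (pd j (pd k F)) u -
      ∑ m, (pd i (christoffel F m j k) u • pd m F u
        + christoffel F m j k u • pd i (pd m F) u) := by
  have hΓ := fun m => differentiableAt_of_contDiffOn (contDiffOn_christoffel hF hU hdet m j k) hU hu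
  have hpd := fun m => differentiableAt_of_contDiffOn (contDiffOn_pd hF hU m) hU hu
  have hpdpd := differentiableAt_of_contDiffOn (contDiffOn_pd (contDiffOn_pd hF hU k) hU j) hU hu
  change fderiv ℝ (fun v => pd j (pd k F) v - ∑ m, christoffel F m j k v • pd m F v) u _ = _
  rw [fderiv_fun_sub hpdpd (.fun_sum fun m _ => (hΓ m).fun_smul (hpd m)), sub_apply,
    fderiv_fun_sum fun m _ => (hΓ m).fun_smul (hpd m), sum_apply]
  exact congrArg₂ _ rfl (Finset.sum_congr rfl fun m _ => fderiv_fun_smul_apply (hΓ m) (hpd m) _)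

theorem gauss_equation (hF : ContDiffOn ℝ ∞ F U) (hU : IsOpen U)
    (hdet : ∀ u ∈ U, (gram F u).det ≠ 0) (hu : u ∈ U) (i j k l : Fin 2) :
    ∑ m, curvature F m k i j u * gram F u m l =
      metric (secondForm F j k u) (secondForm F i l u) -
        metric (secondForm F i k u) (secondForm F j l u) := by
  have hi := metric_pd_secondForm hF hU hdet hu i j k l
  have hj := metric_pd_secondForm hF hU hdet hu j i k l
  rw [pd_secondForm hF hU hdet hu, pd_comm (contDiffOn_pd hF hU k) hU hu i j] at hi
  rw [pd_secondForm hF hU hdet hu] at hj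
  have hΓ := fun i m => sum_christoffel_gram hF hU hu (hdet u hu) i m l
  simp only [metric_sub_left, metric_add_left, metric_smul_left, ← hΓ, Fin.sum_univ_two,
    gram_apply] at hi hj
  simp only [curvature, Fin.sum_univ_two, gram_apply]
  linear_combination hj - hi

/-- The second fundamental form `h(X, Y) = ∑ Xⁱ Yʲ h(∂ᵢ, ∂ⱼ)` of the parametrized surface `F` on
parameter vectors. -/
noncomputable def secondFundamentalForm (F : E2 → ℂ × ℂ) (u X Y : E2) : ℂ × ℂ :=
  ∑ i, ∑ j, (X i * Y j) • secondForm F i j u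

theorem secondFundamentalForm_comm (hF : ContDiffOn ℝ ∞ F U) (hU : IsOpen U) (hu : u ∈ U)
    (X Y : E2) : secondFundamentalForm F u X Y = secondFundamentalForm F u Y X := by
  rw [secondFundamentalForm, Finset.sum_comm]
  simp only [secondFundamentalForm, secondForm_comm hF hU hu, mul_comm]

theorem metric_secondFundamentalForm_fderiv (hF : ContDiffOn ℝ ∞ F U) (hU : IsOpen U)
    (hu : u ∈ U) (hdet : (gram F u).det ≠ 0) (X Y Z : E2) :
    metric (secondFundamentalForm F u X Y) (fderiv ℝ F u Z) = 0 := by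
  rw [metric_comm, fderiv_apply_eq_sum_pd]
  simp only [metric_sum_left, metric_smul_left, metric_comm (pd _ F u), secondFundamentalForm,
    metric_secondForm_pd hF hU hu hdet, mul_zero, Finset.sum_const_zero]

theorem exists_fderiv_fderiv_eq (hF : DifferentiableAt ℝ (fderiv ℝ F) u) (v w : E2) :
    ∃ Z, fderiv ℝ (fderiv ℝ F) u v w = fderiv ℝ F u Z + secondFundamentalForm F u v w := by
  refine ⟨∑ i, ∑ j, (v i * w j) • ∑ k, christoffel F k i j u • EuclideanSpace.single k 1, ?_⟩
  have hpd : ∀ i j, pd i (pd j F) u =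
      (∑ k, christoffel F k i j u • pd k F u) + secondForm F i j u := fun i j => by
    simp [secondForm]
  have hexpand : fderiv ℝ (fderiv ℝ F) u v w = ∑ i, ∑ j, (v i * w j) • pd i (pd j F) u := by
    conv_lhs => rw [eq_sum_smul_single v, eq_sum_smul_single w]
    simp only [map_sum, map_smul, sum_apply, smul_apply, pd_pd_eq_fderiv_fderiv hF,
      Finset.smul_sum, smul_smul]
    exact Finset.sum_comm.trans (by simp only [mul_comm])
  simp only [hexpand, hpd, secondFundamentalForm, smul_add, Finset.sum_add_distrib, map_sum,
    map_smul]
  rfl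

theorem metric_secondFundamentalForm_of_flat (hF : ContDiffOn ℝ ∞ F U) (hU : IsOpen U)
    (hdet : ∀ u ∈ U, (gram F u).det ≠ 0) (hu : u ∈ U)
    (hflat : ∀ l k i j, curvature F l k i j u = 0) (X Y Z W : E2) :
    metric (secondFundamentalForm F u X Z) (secondFundamentalForm F u Y W) =
      metric (secondFundamentalForm F u Y Z) (secondFundamentalForm F u X W) := by
  have hgauss : ∀ i j k l, metric (secondForm F j k u) (secondForm F i l u) =
      metric (secondForm F i k u) (secondForm F j l u) := fun i j k l => by
    have := gauss_equation hF hU hdet hu i j k l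
    simp only [hflat, zero_mul, Finset.sum_const_zero] at this
    linarith
  simp only [secondFundamentalForm, Fin.sum_univ_two, metric_add_left, metric_add_right,
    metric_smul_left, metric_smul_right]
  rw [hgauss 1 0 0 0, hgauss 1 0 0 1, hgauss 1 0 1 0, hgauss 1 0 1 1]
  ring

theorem gram_left_inv_of_isNullPair {X Y : E2}
    (h : IsNullPair (fderiv ℝ F u X) (fderiv ℝ F u Y)) :
    (Matrix.of fun i j => -(X i * Y j + Y i * X j)) * gram F u = 1 := by
  ext i j
  have hj := congrArg (· i) (h.eq_smul_add_smul (T := (fderiv ℝ F u).toLinearMap)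
    finrank_euclideanSpace_fin (EuclideanSpace.single j 1))
  have hpd : ∀ Z : E2, metric (pd j F u) (fderiv ℝ F u Z) = ∑ k, Z k * gram F u k j := fun Z => by
    simp only [fderiv_apply_eq_sum_pd F u Z, metric_comm (pd j F u), metric_sum_left,
      metric_smul_left, gram_apply]
  simp only [PiLp.add_apply, PiLp.smul_apply, smul_eq_mul, ContinuousLinearMap.coe_coe] at hj
  change _ = -metric (pd j F u) _ * _ + -metric (pd j F u) _ * _ at hj
  rw [hpd, hpd] at hj
  rw [Matrix.one_apply, Matrix.mul_apply]
  simp only [PiLp.single_apply, Fin.sum_univ_two, Matrix.of_apply] at hj ⊢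
  rw [hj]
  ring

theorem meanCurvature_of_isNullPair (hF : ContDiffOn ℝ ∞ F U) (hU : IsOpen U) (hu : u ∈ U)
    {X Y : E2} (h : IsNullPair (fderiv ℝ F u X) (fderiv ℝ F u Y)) :
    meanCurvature F u = -secondFundamentalForm F u X Y := by
  have hsum : ∑ i, ∑ j, (gram F u)⁻¹ i j • secondForm F i j u =
      -(secondFundamentalForm F u X Y + secondFundamentalForm F u Y X) := by
    simp only [Matrix.inv_eq_left_inv (gram_left_inv_of_isNullPair h), Matrix.of_apply,
      secondFundamentalForm, neg_smul, add_smul,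
      Finset.sum_neg_distrib, Finset.sum_add_distrib]
  rw [meanCurvature, hsum, secondFundamentalForm_comm hF hU hu Y X]
  module

end Gauss

/-! ### Null coordinates on flat surfaces -/

theorem det_gram_ne_zero_of_isNullPair {F : E2 → ℂ × ℂ} {u X Y : E2}
    (h : IsNullPair (fderiv ℝ F u X) (fderiv ℝ F u Y)) : (gram F u).det ≠ 0 :=
  (Matrix.isUnit_det_of_left_inverse (gram_left_inv_of_isNullPair h)).ne_zero

theorem isNullPair_of_quadratic {p q : ℂ × ℂ} {w : ℝ} (hw : w ≠ 0) (hD : w + metric p q ≠ 0)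
    (hroot : w ^ 2 + 2 * metric p q * w + metric p p * metric q q = 0) :
    IsNullPair (p + (metric p p / w) • q)
      ((w / (2 * (w + metric p q) ^ 2)) • (q + (metric q q / w) • p)) := by
  constructor <;>
  simp only [metric_add_left, metric_add_right, metric_smul_left, metric_smul_right,
    metric_comm q p] <;>
  field_simp
  · linear_combination metric p p * hroot
  · linear_combination metric q q * hroot
  · linear_combination (2 * w + metric p q) * hroot

section NullFrame

variable {F : E2 → ℂ × ℂ} {U V : Set E2} {u : E2} {X Y : E2 → E2}

/-- The vector field `dF(X)` along the parametrized surface `F` that has the components `X` with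
respect to the coordinate frame. -/
noncomputable def tangentField (F : E2 → ℂ × ℂ) (X : E2 → E2) (u : E2) : ℂ × ℂ := fderiv ℝ F u (X u)

/-- Smooth parameter vector fields on `V` that `dF` maps to a pseudo-orthonormal frame of the
tangent planes of `F`. -/
structure IsNullFrame (F : E2 → ℂ × ℂ) (V : Set E2) (X Y : E2 → E2) : Prop where
  smooth_left : ContDiffOn ℝ ∞ X V
  smooth_right : ContDiffOn ℝ ∞ Y V
  isNullPair : ∀ u ∈ V, IsNullPair (tangentField F X u) (tangentField F Y u)

theorem contDiffOn_tangentField (hF : ContDiffOn ℝ ∞ F U) (hU : IsOpen U)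
    (hX : ContDiffOn ℝ ∞ X U) : ContDiffOn ℝ ∞ (tangentField F X) U :=
  (contDiffOn_fderiv hF hU).clm_apply hX

theorem tangentField_smul (F : E2 → ℂ × ℂ) (c : E2 → ℝ) (X : E2 → E2) :
    tangentField F (fun u => c u • X u) = fun u => c u • tangentField F X u :=
  funext fun u => map_smul (fderiv ℝ F u) (c u) (X u)

theorem exists_isNullFrame_of_forall (hF : ContDiffOn ℝ ∞ F V) (hV : IsOpen V) {X₀ Y₀ : E2}
    (hcross : ∀ u ∈ V, metric (fderiv ℝ F u X₀) (fderiv ℝ F u Y₀) < 0)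
    (hdisc : ∀ u ∈ V, metric (fderiv ℝ F u X₀) (fderiv ℝ F u X₀) *
      metric (fderiv ℝ F u Y₀) (fderiv ℝ F u Y₀) <
        metric (fderiv ℝ F u X₀) (fderiv ℝ F u Y₀) ^ 2) :
    ∃ X Y, IsNullFrame F V X Y := by
  set p := fun u => fderiv ℝ F u X₀
  set q := fun u => fderiv ℝ F u Y₀
  have hp : ContDiffOn ℝ ∞ p V := (contDiffOn_fderiv hF hV).clm_apply contDiffOn_const
  have hq : ContDiffOn ℝ ∞ q V := (contDiffOn_fderiv hF hV).clm_apply contDiffOn_const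
  have hH := contDiffOn_metric hp hq
  set D := fun u => √(metric (p u) (q u) ^ 2 - metric (p u) (p u) * metric (q u) (q u))
  set w := fun u => D u - metric (p u) (q u)
  have hD : ∀ u ∈ V, 0 < D u := fun u hu => Real.sqrt_pos.2 (sub_pos.2 (hdisc u hu))
  have hw : ∀ u ∈ V, w u ≠ 0 := fun u hu => by linarith [hD u hu, hcross u hu]
  have hwD : ∀ u, w u + metric (p u) (q u) = D u := fun u => sub_add_cancel _ _
  have hDs : ContDiffOn ℝ ∞ D V :=
    ((hH.pow 2).sub ((contDiffOn_metric hp hp).mul (contDiffOn_metric hq hq))).sqrt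
      fun u hu => (sub_pos.2 (hdisc u hu)).ne'
  have hws : ContDiffOn ℝ ∞ w V := hDs.sub hH
  refine ⟨fun u => X₀ + (metric (p u) (p u) / w u) • Y₀,
    fun u => (w u / (2 * D u ^ 2)) • (Y₀ + (metric (q u) (q u) / w u) • X₀),
    contDiffOn_const.add (((contDiffOn_metric hp hp).div hws hw).smul contDiffOn_const),
    (hws.div (contDiffOn_const.mul (hDs.pow 2)) fun u hu => by simp [(hD u hu).ne']).smul
      (contDiffOn_const.add (((contDiffOn_metric hq hq).div hws hw).smul contDiffOn_const)),
    fun u hu => ?_⟩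
  have hsq : D u ^ 2 = metric (p u) (q u) ^ 2 - metric (p u) (p u) * metric (q u) (q u) :=
    Real.sq_sqrt (sub_pos.2 (hdisc u hu)).le
  simp only [tangentField, map_add, map_smul, ← hwD]
  refine isNullPair_of_quadratic (hw u hu) (hwD u ▸ (hD u hu).ne') ?_
  linear_combination hsq

theorem exists_isNullFrame (hF : ContDiffOn ℝ ∞ F U) (hU : IsOpen U) (hu : u ∈ U) {X₀ Y₀ : E2}
    (h : IsNullPair (fderiv ℝ F u X₀) (fderiv ℝ F u Y₀)) :
    ∃ V ⊆ U, IsOpen V ∧ Convex ℝ V ∧ u ∈ V ∧ ∃ X Y, IsNullFrame F V X Y := by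
  have hd : ∀ Z : E2, ContDiffOn ℝ ∞ (fun u => fderiv ℝ F u Z) U := fun Z =>
    (contDiffOn_fderiv hF hU).clm_apply contDiffOn_const
  have hcont : ∀ Z W : E2,
      ContinuousAt (fun u => metric (fderiv ℝ F u Z) (fderiv ℝ F u W)) u := fun Z W =>
    (contDiffOn_metric (hd Z) (hd W)).continuousOn.continuousAt (hU.mem_nhds hu)
  have hcross := (hcont X₀ Y₀).eventually_lt_const (by simp [h.cross] : _ < (0 : ℝ))
  have hdisc := ((hcont X₀ X₀).mul (hcont Y₀ Y₀)).eventually_lt ((hcont X₀ Y₀).pow 2)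
    (by simp [h.cross, h.left])
  obtain ⟨r, hr, hball⟩ := Metric.mem_nhds_iff.1
    (Filter.inter_mem (hU.mem_nhds hu) (hcross.and hdisc))
  exact ⟨Metric.ball u r, fun x hx => (hball hx).1, Metric.isOpen_ball, convex_ball _ _,
    Metric.mem_ball_self hr, exists_isNullFrame_of_forall
      (hF.mono fun x hx => (hball hx).1) Metric.isOpen_ball
      (fun x hx => (hball hx).2.1) (fun x hx => (hball hx).2.2)⟩

namespace IsNullFrame

theorem symm (h : IsNullFrame F V X Y) : IsNullFrame F V Y X :=
  ⟨h.smooth_right, h.smooth_left, fun u hu => (h.isNullPair u hu).symm⟩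

theorem fderiv_apply_eq (h : IsNullFrame F V X Y) (hu : u ∈ V) (v : E2) :
    fderiv ℝ F u v = -metric (fderiv ℝ F u v) (tangentField F Y u) • tangentField F X u +
      -metric (fderiv ℝ F u v) (tangentField F X u) • tangentField F Y u := by
  have := congrArg (fderiv ℝ F u) ((h.isNullPair u hu).eq_smul_add_smul
    (T := (fderiv ℝ F u).toLinearMap) finrank_euclideanSpace_fin v)
  rwa [map_add, map_smul, map_smul] at this

theorem metric_fderiv_self (h : IsNullFrame F V X Y) (hF : ContDiffOn ℝ ∞ F V) (hV : IsOpen V)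
    (hu : u ∈ V) (v : E2) :
    metric (fderiv ℝ (tangentField F X) u v) (tangentField F X u) = 0 := by
  have hd := differentiableAt_of_contDiffOn (contDiffOn_tangentField hF hV h.smooth_left) hV hu
  have hconst : (fun u => metric (tangentField F X u) (tangentField F X u)) =ᶠ[nhds u] fun _ => 0 :=
    Filter.eventually_of_mem (hV.mem_nhds hu) fun x hx => (h.isNullPair x hx).left
  have := fderiv_metric hd hd v
  rw [hconst.fderiv_eq, metric_comm (tangentField F X u), fderiv_fun_const, Pi.zero_apply,
    zero_apply] at this
  linarith

theorem metric_fderiv_right (h : IsNullFrame F V X Y) (hF : ContDiffOn ℝ ∞ F V) (hV : IsOpen V)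
    (hu : u ∈ V) (v : E2) :
    metric (fderiv ℝ (tangentField F Y) u v) (tangentField F X u) =
      -metric (fderiv ℝ (tangentField F X) u v) (tangentField F Y u) := by
  have hconst : (fun u => metric (tangentField F X u) (tangentField F Y u)) =ᶠ[nhds u]
      fun _ => -1 :=
    Filter.eventually_of_mem (hV.mem_nhds hu) fun x hx => (h.isNullPair x hx).cross
  have := fderiv_metric
    (differentiableAt_of_contDiffOn (contDiffOn_tangentField hF hV h.smooth_left) hV hu)
    (differentiableAt_of_contDiffOn (contDiffOn_tangentField hF hV h.smooth_right) hV hu) v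
  rw [hconst.fderiv_eq, metric_comm (tangentField F X u), fderiv_fun_const, Pi.zero_apply,
    zero_apply] at this
  linarith

theorem fderiv_left (h : IsNullFrame F V X Y) (hF : ContDiffOn ℝ ∞ F V) (hV : IsOpen V)
    (hu : u ∈ V) (v : E2) :
    fderiv ℝ (tangentField F X) u v =
      -metric (fderiv ℝ (tangentField F X) u v) (tangentField F Y u) • tangentField F X u +
        secondFundamentalForm F u v (X u) := by
  have hnull := h.isNullPair u hu
  have hnormal := metric_secondFundamentalForm_fderiv hF hV hu
    (det_gram_ne_zero_of_isNullPair hnull) v (X u)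
  obtain ⟨Z, hZ⟩ := exists_fderiv_fderiv_eq (differentiableAt_fderiv hF hV hu) v (X u)
  have hd : fderiv ℝ (tangentField F X) u v =
      fderiv ℝ F u (Z + fderiv ℝ X u v) + secondFundamentalForm F u v (X u) := by
    have := fderiv_fderiv_apply (differentiableAt_fderiv hF hV hu)
      (differentiableAt_of_contDiffOn h.smooth_left hV hu) v
    rw [hZ] at this
    rw [map_add, add_right_comm, ← this]
    rfl
  have hX : metric (fderiv ℝ F u (Z + fderiv ℝ X u v)) (tangentField F X u) = 0 := by
    rw [← h.metric_fderiv_self hF hV hu v, hd, metric_add_left, tangentField, hnormal, add_zero]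
  have hY : metric (fderiv ℝ F u (Z + fderiv ℝ X u v)) (tangentField F Y u) =
      metric (fderiv ℝ (tangentField F X) u v) (tangentField F Y u) := by
    rw [hd, metric_add_left, tangentField, hnormal, add_zero]
  rw [← hY]
  conv_lhs => rw [hd, h.fderiv_apply_eq hu, hX, neg_zero, zero_smul, add_zero]

theorem metric_fderiv_fderiv_comm (h : IsNullFrame F V X Y) (hF : ContDiffOn ℝ ∞ F V)
    (hV : IsOpen V) (hflat : ∀ u ∈ V, ∀ l k i j, curvature F l k i j u = 0) (hu : u ∈ V)
    (v w : E2) :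
    metric (fderiv ℝ (tangentField F Y) u v) (fderiv ℝ (tangentField F X) u w) =
      metric (fderiv ℝ (tangentField F Y) u w) (fderiv ℝ (tangentField F X) u v) := by
  have hdet := fun u hu => det_gram_ne_zero_of_isNullPair (h.isNullPair u hu)
  have hnormal := metric_secondFundamentalForm_fderiv hF hV hu (hdet u hu)
  set κ := fun v => metric (fderiv ℝ (tangentField F X) u v) (tangentField F Y u)
  have hdX : ∀ v, fderiv ℝ (tangentField F X) u v =
      -κ v • tangentField F X u + secondFundamentalForm F u v (X u) := h.fderiv_left hF hV hu
  have hdY : ∀ v, fderiv ℝ (tangentField F Y) u v =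
      κ v • tangentField F Y u + secondFundamentalForm F u v (Y u) := fun v => by
    rw [h.symm.fderiv_left hF hV hu v, h.metric_fderiv_right hF hV hu v, neg_neg]
  have hprod : ∀ v w, metric (fderiv ℝ (tangentField F Y) u v) (fderiv ℝ (tangentField F X) u w) =
      κ v * κ w + metric (secondFundamentalForm F u v (Y u))
        (secondFundamentalForm F u w (X u)) := fun v w => by
    rw [hdX, hdY, metric_add_left, metric_add_right, metric_add_right,
      metric_comm (κ v • _) (secondFundamentalForm F u w _)]
    simp only [metric_smul_left, metric_smul_right, (h.isNullPair u hu).symm.cross]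
    simp only [tangentField, hnormal]
    ring
  rw [hprod, hprod, metric_secondFundamentalForm_of_flat hF hV hdet hu (hflat u hu)]
  ring

theorem exists_parallel (h : IsNullFrame F V X Y) (hF : ContDiffOn ℝ ∞ F V)
    (hV : IsOpen V) (hconv : Convex ℝ V)
    (hflat : ∀ u ∈ V, ∀ l k i j, curvature F l k i j u = 0) :
    ∃ X' Y', IsNullFrame F V X' Y' ∧ ∀ u ∈ V, ∀ v,
      metric (fderiv ℝ (tangentField F X') u v) (tangentField F Y' u) = 0 := by
  have hA := contDiffOn_tangentField hF hV h.smooth_left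
  have hB := contDiffOn_tangentField hF hV h.smooth_right
  obtain ⟨ρ, hρ, hdρ⟩ := exists_primitive_metric_fderiv hV hconv hA hB
    fun u hu => h.metric_fderiv_fderiv_comm hF hV hflat hu
  refine ⟨fun u => Real.exp (ρ u) • X u, fun u => Real.exp (-ρ u) • Y u,
    ⟨hρ.exp.smul h.smooth_left, hρ.neg.exp.smul h.smooth_right, fun u hu => ?_⟩, fun u hu v => ?_⟩
  · simp only [tangentField_smul]
    exact (h.isNullPair u hu).smul_smul (by rw [← Real.exp_add, add_neg_cancel, Real.exp_zero])
  · have hexp := (differentiableAt_of_contDiffOn hρ hV hu).hasFDerivAt.exp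
    rw [tangentField_smul, tangentField_smul, fderiv_fun_smul_apply hexp.differentiableAt
      (differentiableAt_of_contDiffOn hA hV hu), hexp.fderiv, smul_apply, hdρ u hu,
      metric_comm (tangentField F Y u)]
    simp only [metric_smul_right, metric_add_left, metric_smul_left, smul_eq_mul,
      (h.isNullPair u hu).cross]
    ring

theorem exists_null_coordinates (h : IsNullFrame F V X Y) (hF : ContDiffOn ℝ ∞ F V)
    (hV : IsOpen V) (hconv : Convex ℝ V)
    (hflat : ∀ u ∈ V, ∀ l k i j, curvature F l k i j u = 0) :
    ∃ χ : E2 → ℝ × ℝ, ContDiffOn ℝ ∞ χ V ∧ ∀ u ∈ V, ∀ v w,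
      metric (fderiv ℝ F u v) (fderiv ℝ F u w) =
        -((fderiv ℝ χ u v).1 * (fderiv ℝ χ u w).2) - (fderiv ℝ χ u v).2 * (fderiv ℝ χ u w).1 := by
  obtain ⟨X, Y, h, hparallel⟩ := h.exists_parallel hF hV hconv hflat
  have hclosed : ∀ {X Y}, IsNullFrame F V X Y → (∀ u ∈ V, ∀ v,
      metric (fderiv ℝ (tangentField F X) u v) (tangentField F Y u) = 0) → ∃ f : E2 → ℝ,
      ContDiffOn ℝ ∞ f V ∧ ∀ u ∈ V, ∀ v,
        fderiv ℝ f u v = metric (tangentField F X u) (fderiv ℝ F u v) := by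
    intro X Y h hparallel
    refine exists_primitive_metric_fderiv hV hconv hF
      (contDiffOn_tangentField hF hV h.smooth_left) fun u hu v w => ?_
    have hnormal := metric_secondFundamentalForm_fderiv hF hV hu
      (det_gram_ne_zero_of_isNullPair (h.isNullPair u hu))
    rw [h.fderiv_left hF hV hu, h.fderiv_left hF hV hu w, hparallel u hu, hparallel u hu]
    simp [hnormal]
  obtain ⟨x, hx, hdx⟩ := hclosed h.symm fun u hu v => by
    rw [h.metric_fderiv_right hF hV hu, hparallel u hu, neg_zero]
  obtain ⟨y, hy, hdy⟩ := hclosed h hparallel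
  refine ⟨fun u => (x u, y u), hx.prodMk hy, fun u hu v w => ?_⟩
  rw [(differentiableAt_of_contDiffOn hx hV hu).fderiv_prodMk
    (differentiableAt_of_contDiffOn hy hV hu)]
  simp only [ContinuousLinearMap.prod_apply, hdx u hu, hdy u hu]
  conv_lhs => rw [h.fderiv_apply_eq hu v]
  simp only [metric_add_left, metric_smul_left, metric_comm (fderiv ℝ F u v)]
  ring

end IsNullFrame

end NullFrame

section Existence

variable {M : Type*} [TopologicalSpace M] [ChartedSpace E2 M] {L : M → ℂ × ℂ} {θ : ℝ}
  {F : E2 → ℂ × ℂ} {U : Set E2} {u : E2}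

theorem contDiffOn_comp_chart_symm [IsManifold (𝓡 2) ∞ M]
    (hL : ContMDiff (𝓡 2) 𝓘(ℝ, ℂ × ℂ) ∞ L) {e : OpenPartialHomeomorph M E2}
    (he : e ∈ atlas E2 M) : ContDiffOn ℝ ∞ (L ∘ e.symm) e.target :=
  contMDiffOn_iff_contDiffOn.1 (hL.comp_contMDiffOn
    (contMDiffOn_symm_of_mem_maximalAtlas (IsManifold.subset_maximalAtlas he)))

theorem exists_isNullPair_of_isSlantPlane (h : IsSlantPlane θ (tangentPlane F u)) :
    ∃ X Y, IsNullPair (fderiv ℝ F u X) (fderiv ℝ F u Y) := by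
  obtain ⟨-, _, ⟨X, rfl⟩, _, ⟨Y, rfl⟩, hX, hY, hXY, -⟩ := h
  exact ⟨X, Y, hX, hY, hXY⟩

theorem exists_openPartialHomeomorph_of_injective {E G : Type*} [NormedAddCommGroup E]
    [NormedSpace ℝ E] [FiniteDimensional ℝ E] [NormedAddCommGroup G] [NormedSpace ℝ G]
    [FiniteDimensional ℝ G] (hfinrank : Module.finrank ℝ E = Module.finrank ℝ G) {χ : E → G}
    {V : Set E} {u : E} (hχ : ContDiffOn ℝ ∞ χ V) (hV : IsOpen V) (hu : u ∈ V)
    (hinj : ∀ v ∈ V, Function.Injective (fderiv ℝ χ v)) :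
    ∃ R : OpenPartialHomeomorph E G, ⇑R = χ ∧ u ∈ R.source ∧ R.source ⊆ V ∧
      ContDiffOn ℝ ∞ R.symm R.target := by
  have := FiniteDimensional.complete ℝ E
  have hderiv : ∀ v ∈ V, ∃ χ' : E ≃L[ℝ] G, HasFDerivAt χ (χ' : E →L[ℝ] G) v := fun v hv =>
    ⟨(LinearEquiv.ofInjectiveOfFinrankEq (fderiv ℝ χ v : E →ₗ[ℝ] G) (hinj v hv)
      hfinrank).toContinuousLinearEquiv, (differentiableAt_of_contDiffOn hχ hV hv).hasFDerivAt⟩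
  have hχ : ∀ v ∈ V, ContDiffAt ℝ ∞ χ v := fun v hv => hχ.contDiffAt (hV.mem_nhds hv)
  obtain ⟨_, hχ'⟩ := hderiv u hu
  let R := ((hχ u hu).toOpenPartialHomeomorph χ hχ' (by simp)).restrOpen V hV
  have hRV : R.source ⊆ V := fun v hv => hv.2
  refine ⟨R, rfl, ⟨(hχ u hu).mem_toOpenPartialHomeomorph_source hχ' (by simp), hu⟩, hRV,
    fun q hq => ?_⟩
  have hqV := hRV (R.map_target hq)
  obtain ⟨_, hχ'⟩ := hderiv _ hqV
  exact (R.contDiffAt_symm hq hχ' (hχ _ hqV)).contDiffWithinAt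

theorem exists_null_chart (hF : ContDiffOn ℝ ∞ F U) (hU : IsOpen U)
    (hnull : ∀ u ∈ U, ∃ X Y, IsNullPair (fderiv ℝ F u X) (fderiv ℝ F u Y))
    (hflat : ∀ u ∈ U, ∀ l k i j, curvature F l k i j u = 0) (hu : u ∈ U) :
    ∃ R : OpenPartialHomeomorph E2 (ℝ × ℝ), u ∈ R.source ∧ R.source ⊆ U ∧
      ContDiffOn ℝ ∞ R.symm R.target ∧ ∀ q ∈ R.target, ∀ v w,
        metric (fderiv ℝ (F ∘ R.symm) q v) (fderiv ℝ (F ∘ R.symm) q w) =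
          -(v.1 * w.2) - v.2 * w.1 := by
  obtain ⟨_, _, hXY⟩ := hnull u hu
  obtain ⟨V, hVU, hV, hconv, huV, X, Y, hframe⟩ := exists_isNullFrame hF hU hu hXY
  obtain ⟨χ, hχ, hmetric⟩ := hframe.exists_null_coordinates (hF.mono hVU) hV hconv
    fun v hv => hflat v (hVU hv)
  have hinj : ∀ v ∈ V, Function.Injective (fderiv ℝ χ v) := fun v hv =>
    (injective_iff_map_eq_zero _).2 fun z hz => by
      have hzero : ∀ w, metric (fderiv ℝ F v z) (fderiv ℝ F v w) = 0 := fun w => by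
        simp [hmetric v hv, hz]
      have hexpand := (hframe.isNullPair v hv).eq_smul_add_smul
        (T := (fderiv ℝ F v : E2 →ₗ[ℝ] ℂ × ℂ)) (by simp) z
      simpa [hzero] using hexpand
  obtain ⟨R, rfl, huR, hRV, hsymm⟩ :=
    exists_openPartialHomeomorph_of_injective (by simp) hχ hV huV hinj
  refine ⟨R, huR, hRV.trans hVU, hsymm, fun q hq v w => ?_⟩
  have hqV := hRV (R.map_target hq)
  have hdsymm := differentiableAt_of_contDiffOn hsymm R.open_target hq
  have hright : ∀ v, fderiv ℝ R (R.symm q) (fderiv ℝ R.symm q v) = v := fun v => by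
    have hid : R ∘ R.symm =ᶠ[nhds q] id := by
      filter_upwards [R.open_target.mem_nhds hq] with x hx using R.right_inv hx
    rw [← ContinuousLinearMap.comp_apply,
      ← fderiv_comp q (differentiableAt_of_contDiffOn hχ hV hqV) hdsymm, hid.fderiv_eq,
      fderiv_id, ContinuousLinearMap.id_apply]
  rw [fderiv_comp q (differentiableAt_of_contDiffOn hF hU (hVU hqV)) hdsymm]
  simp only [ContinuousLinearMap.comp_apply, hmetric _ hqV, hright]

theorem exists_box_subset {U : Set (ℝ × ℝ)} (hU : IsOpen U) {q : ℝ × ℝ} (hq : q ∈ U) :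
    ∃ I K : Set ℝ, IsOpen I ∧ I.OrdConnected ∧ IsOpen K ∧ K.OrdConnected ∧ q ∈ I ×ˢ K ∧
      I ×ˢ K ⊆ U := by
  obtain ⟨r, hr, h⟩ := Metric.isOpen_iff.1 hU q hq
  refine ⟨Metric.ball q.1 r, Metric.ball q.2 r, Metric.isOpen_ball,
    (convex_ball _ _).ordConnected, Metric.isOpen_ball, (convex_ball _ _).ordConnected,
    ⟨Metric.mem_ball_self hr, Metric.mem_ball_self hr⟩, ?_⟩
  rwa [ball_prod_same]

theorem exists_isNullRectangle [IsManifold (𝓡 2) ∞ M]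
    (hL : ContMDiff (𝓡 2) 𝓘(ℝ, ℂ × ℂ) ∞ L) (hflat : IsFlat L) (hslant : IsSlant θ L) (p : M) :
    ∃ (I K : Set ℝ) (φ : ℝ × ℝ → M), IsNullRectangle L I K φ ∧ Set.InjOn φ (I ×ˢ K) ∧
      p ∈ φ '' (I ×ˢ K) ∧ IsOpen (φ '' (I ×ˢ K)) := by
  let e := chartAt E2 p
  have he : e ∈ atlas E2 M := chart_mem_atlas E2 p
  have hp : p ∈ e.source := mem_chart_source E2 p
  obtain ⟨R, hpR, hRe, hsymm, hiso⟩ := exists_null_chart (contDiffOn_comp_chart_symm hL he)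
    e.open_target (fun u hu => exists_isNullPair_of_isSlantPlane (hslant e he u hu))
    (fun u hu => hflat e he u hu) (e.map_source hp)
  obtain ⟨I, K, hI, hI', hK, hK', hpIK, hIK⟩ :=
    exists_box_subset R.open_target (R.map_source hpR)
  have hmaps : Set.MapsTo R.symm (I ×ˢ K) e.target := fun q hq => hRe (R.map_target (hIK hq))
  refine ⟨I, K, e.symm ∘ R.symm, ⟨hI, hI', hK, hK', ?_, fun q hq => hiso q (hIK hq)⟩,
    e.symm.injOn.comp (R.symm.injOn.mono hIK) hmaps, ⟨R (e p), hpIK, ?_⟩, ?_⟩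
  · exact (contMDiffOn_symm_of_mem_maximalAtlas (IsManifold.subset_maximalAtlas he)).comp
      (contMDiffOn_iff_contDiffOn.2 (hsymm.mono hIK)) hmaps
  · rw [Function.comp_apply, R.left_inv hpR, e.left_inv hp]
  · rw [Set.image_comp]
    exact e.isOpen_image_symm_of_subset_target
      (R.isOpen_image_symm_of_subset_target (hI.prod hK) hIK) hmaps.image_subset

end Existence

/-! ### Null rectangles -/

theorem exists_fderiv_fderiv_comp_eq {E : Type*} [NormedAddCommGroup E] [NormedSpace ℝ E]
    {F : E2 → ℂ × ℂ} {U : Set E2} {ξ : E → E2} {V : Set E} {q : E} (hF : ContDiffOn ℝ ∞ F U)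
    (hU : IsOpen U) (hξ : ContDiffOn ℝ ∞ ξ V) (hV : IsOpen V) (hmaps : Set.MapsTo ξ V U)
    (hq : q ∈ V) (v w : E) :
    ∃ Z, fderiv ℝ (fderiv ℝ (F ∘ ξ)) q v w =
      fderiv ℝ F (ξ q) Z + secondFundamentalForm F (ξ q) (fderiv ℝ ξ q v) (fderiv ℝ ξ q w) := by
  have hdF := differentiableAt_fderiv hF hU (hmaps hq)
  have hdξ := differentiableAt_of_contDiffOn hξ hV hq
  have hchain : fderiv ℝ (F ∘ ξ) =ᶠ[nhds q] fun x => (fderiv ℝ F (ξ x)).comp (fderiv ℝ ξ x) := by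
    filter_upwards [hV.mem_nhds hq] with x hx
    exact fderiv_comp x (differentiableAt_of_contDiffOn hF hU (hmaps hx))
      (differentiableAt_of_contDiffOn hξ hV hx)
  have hsecond : HasFDerivAt (fun x => (fderiv ℝ F (ξ x)).comp (fderiv ℝ ξ x)) _ q :=
    (hdF.hasFDerivAt.comp q hdξ.hasFDerivAt).clm_comp
      (differentiableAt_fderiv hξ hV hq).hasFDerivAt
  obtain ⟨Z, hZ⟩ := exists_fderiv_fderiv_eq hdF (fderiv ℝ ξ q v) (fderiv ℝ ξ q w)
  refine ⟨fderiv ℝ (fderiv ℝ ξ) q v w + Z, ?_⟩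
  rw [hchain.fderiv_eq, hsecond.fderiv, map_add, add_assoc, ← hZ]
  rfl

theorem fderiv_comp_swap {V : Type*} [NormedAddCommGroup V] [NormedSpace ℝ V] (G : ℝ × ℝ → V)
    (q v : ℝ × ℝ) : fderiv ℝ (G ∘ Prod.swap) q v = fderiv ℝ G q.swap v.swap :=
  DFunLike.congr_fun ((ContinuousLinearEquiv.prodComm ℝ ℝ ℝ).comp_right_fderiv (f := G) (x := q)) v

section NullRectangle

variable {M : Type*} [TopologicalSpace M] [ChartedSpace E2 M] {L : M → ℂ × ℂ} {θ : ℝ}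
  {I K : Set ℝ} {φ : ℝ × ℝ → M} {q : ℝ × ℝ}

/-- The tangent plane of the surface `L` at `p`, computed in the preferred chart at `p`. -/
noncomputable def tangentPlaneAt (L : M → ℂ × ℂ) (p : M) : Submodule ℝ (ℂ × ℂ) :=
  tangentPlane (L ∘ (chartAt E2 p).symm) (chartAt E2 p p)

theorem IsSlant.isSlantPlane_tangentPlaneAt (h : IsSlant θ L) (p : M) :
    IsSlantPlane θ (tangentPlaneAt L p) :=
  h _ (chart_mem_atlas E2 p) _ (mem_chart_target E2 p)

namespace IsNullRectangle

theorem isOpen (h : IsNullRectangle L I K φ) : IsOpen (I ×ˢ K) :=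
  h.open_left.prod h.open_right

theorem convex (h : IsNullRectangle L I K φ) : Convex ℝ (I ×ˢ K) :=
  h.interval_left.convex.prod h.interval_right.convex

theorem swap (h : IsNullRectangle L I K φ) : IsNullRectangle L K I (φ ∘ Prod.swap) where
  open_left := h.open_right
  interval_left := h.interval_right
  open_right := h.open_left
  interval_right := h.interval_left
  smooth := h.smooth.comp (contMDiffOn_iff_contDiffOn.2
    (ContinuousLinearEquiv.prodComm ℝ ℝ ℝ).contDiff.contDiffOn) fun _ hq => ⟨hq.2, hq.1⟩
  isometric q hq v w := by
    rw [← Function.comp_assoc, fderiv_comp_swap, fderiv_comp_swap, h.isometric _ ⟨hq.2, hq.1⟩]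
    simp only [Prod.fst_swap, Prod.snd_swap]
    ring

theorem contDiffOn (h : IsNullRectangle L I K φ) (hL : ContMDiff (𝓡 2) 𝓘(ℝ, ℂ × ℂ) ∞ L) :
    ContDiffOn ℝ ∞ (L ∘ φ) (I ×ˢ K) :=
  contMDiffOn_iff_contDiffOn.1 (hL.comp_contMDiffOn h.smooth)

theorem isNullPair (h : IsNullRectangle L I K φ) (hq : q ∈ I ×ˢ K) :
    IsNullPair (fderiv ℝ (L ∘ φ) q (1, 0)) (fderiv ℝ (L ∘ φ) q (0, 1)) := by
  refine ⟨?_, ?_, ?_⟩ <;> rw [h.isometric q hq] <;> simp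

variable [IsManifold (𝓡 2) ∞ M]

theorem exists_fderiv_eq (h : IsNullRectangle L I K φ)
    (hL : ContMDiff (𝓡 2) 𝓘(ℝ, ℂ × ℂ) ∞ L) (hq : q ∈ I ×ˢ K) {e : OpenPartialHomeomorph M E2}
    (he : e ∈ atlas E2 M) (hqe : φ q ∈ e.source) :
    ∃ T : ℝ × ℝ →L[ℝ] E2,
      (∀ v, fderiv ℝ (L ∘ φ) q v = fderiv ℝ (L ∘ e.symm) (e (φ q)) (T v)) ∧
      ∀ v w, ∃ Z, fderiv ℝ (fderiv ℝ (L ∘ φ)) q v w =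
        fderiv ℝ (L ∘ e.symm) (e (φ q)) Z +
          secondFundamentalForm (L ∘ e.symm) (e (φ q)) (T v) (T w) := by
  let V := I ×ˢ K ∩ φ ⁻¹' e.source
  have hV : IsOpen V := h.smooth.continuousOn.isOpen_inter_preimage h.isOpen e.open_source
  have hqV : q ∈ V := ⟨hq, hqe⟩
  have hξ : ContDiffOn ℝ ∞ (e ∘ φ) V := contMDiffOn_iff_contDiffOn.1
    ((contMDiffOn_of_mem_maximalAtlas (IsManifold.subset_maximalAtlas he)).comp
      (h.smooth.mono Set.inter_subset_left) fun x hx => hx.2)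
  have hmaps : Set.MapsTo (e ∘ φ) V e.target := fun x hx => e.map_source hx.2
  have hF := contDiffOn_comp_chart_symm hL he
  have hcomp : L ∘ φ =ᶠ[nhds q] (L ∘ e.symm) ∘ (e ∘ φ) := by
    filter_upwards [hV.mem_nhds hqV] with x hx
    simp only [Function.comp_apply, e.left_inv hx.2]
  refine ⟨fderiv ℝ (e ∘ φ) q, fun v => ?_, fun v w => ?_⟩
  · rw [hcomp.fderiv_eq, fderiv_comp q
      (differentiableAt_of_contDiffOn hF e.open_target (hmaps hqV))
      (differentiableAt_of_contDiffOn hξ hV hqV)]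
    rfl
  · rw [hcomp.fderiv.fderiv_eq]
    exact exists_fderiv_fderiv_comp_eq hF e.open_target hξ hV hmaps hqV v w

theorem range_fderiv (h : IsNullRectangle L I K φ) (hL : ContMDiff (𝓡 2) 𝓘(ℝ, ℂ × ℂ) ∞ L)
    (hq : q ∈ I ×ˢ K) :
    LinearMap.range (fderiv ℝ (L ∘ φ) q : ℝ × ℝ →ₗ[ℝ] ℂ × ℂ) = tangentPlaneAt L (φ q) := by
  obtain ⟨T, hT, -⟩ :=
    h.exists_fderiv_eq hL hq (chart_mem_atlas E2 (φ q)) (mem_chart_source E2 (φ q))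
  have hinj := IsNullPair.injective (T := (fderiv ℝ (L ∘ φ) q : ℝ × ℝ →ₗ[ℝ] ℂ × ℂ))
    (h.isNullPair hq) (by simp)
  have hTinj : Function.Injective (T : ℝ × ℝ →ₗ[ℝ] E2) := fun v w hvw => hinj <| by
    simp only [ContinuousLinearMap.coe_coe] at hvw ⊢
    rw [hT, hT, hvw]
  have hTsurj := (LinearMap.injective_iff_surjective_of_finrank_eq_finrank (by simp)).1 hTinj
  apply le_antisymm
  · rintro _ ⟨v, rfl⟩
    exact ⟨T v, (hT v).symm⟩
  · rintro _ ⟨Z, rfl⟩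
    obtain ⟨v, rfl⟩ := hTsurj Z
    exact ⟨v, hT v⟩

theorem fderiv_fderiv_eq_zero_of_mem (h : IsNullRectangle L I K φ)
    (hL : ContMDiff (𝓡 2) 𝓘(ℝ, ℂ × ℂ) ∞ L) (hq : q ∈ I ×ˢ K) {v w : ℝ × ℝ}
    (hmem : fderiv ℝ (fderiv ℝ (L ∘ φ)) q v w ∈ tangentPlaneAt L (φ q)) :
    fderiv ℝ (fderiv ℝ (L ∘ φ)) q v w = 0 := by
  obtain ⟨z, hz⟩ := h.range_fderiv hL hq ▸ hmem
  have hnormal := metric_fderiv_fderiv_eq_zero (h.contDiffOn hL) h.isOpen h.isometric hq v w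
  rw [← hz] at hnormal ⊢
  have hexpand := IsNullPair.eq_smul_add_smul
    (T := (fderiv ℝ (L ∘ φ) q : ℝ × ℝ →ₗ[ℝ] ℂ × ℂ)) (h.isNullPair hq) (by simp) z
  simp only [ContinuousLinearMap.coe_coe] at hnormal hexpand ⊢
  rw [hexpand, hnormal, hnormal]
  simp

theorem fderiv_fderiv_eq_zero_of_isMinimal (h : IsNullRectangle L I K φ)
    (hL : ContMDiff (𝓡 2) 𝓘(ℝ, ℂ × ℂ) ∞ L) (hmin : IsMinimal L) (hq : q ∈ I ×ˢ K) :
    fderiv ℝ (fderiv ℝ (L ∘ φ)) q (1, 0) (0, 1) = 0 := by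
  apply h.fderiv_fderiv_eq_zero_of_mem hL hq
  have he := chart_mem_atlas E2 (φ q)
  obtain ⟨T, hT, hsecond⟩ := h.exists_fderiv_eq hL hq he (mem_chart_source E2 (φ q))
  obtain ⟨Z, hZ⟩ := hsecond (1, 0) (0, 1)
  have hpair := h.isNullPair hq
  rw [hT, hT] at hpair
  have hzero : meanCurvature _ _ = 0 := hmin _ he _ (mem_chart_target E2 (φ q))
  rw [meanCurvature_of_isNullPair (contDiffOn_comp_chart_symm hL he) (chartAt E2 (φ q)).open_target
    (mem_chart_target E2 (φ q)) hpair, neg_eq_zero] at hzero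
  exact ⟨Z, by rw [hZ, hzero, add_zero]; rfl⟩

theorem fderiv_fderiv_eq_zero_of_isTotallyGeodesic (h : IsNullRectangle L I K φ)
    (hL : ContMDiff (𝓡 2) 𝓘(ℝ, ℂ × ℂ) ∞ L) (hgeo : IsTotallyGeodesic L) (hq : q ∈ I ×ˢ K) :
    fderiv ℝ (fderiv ℝ (L ∘ φ)) q = 0 := by
  refine ContinuousLinearMap.ext fun v => ContinuousLinearMap.ext fun w => ?_
  apply h.fderiv_fderiv_eq_zero_of_mem hL hq
  have he := chart_mem_atlas E2 (φ q)
  obtain ⟨T, -, hsecond⟩ := h.exists_fderiv_eq hL hq he (mem_chart_source E2 (φ q))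
  obtain ⟨Z, hZ⟩ := hsecond v w
  have hzero := hgeo _ he _ (mem_chart_target E2 (φ q))
  refine ⟨Z, ?_⟩
  simp only [hZ, secondFundamentalForm, hzero, smul_zero, Finset.sum_const_zero, add_zero]
  rfl

theorem metric_cplxJ_sq (h : IsNullRectangle L I K φ) (hL : ContMDiff (𝓡 2) 𝓘(ℝ, ℂ × ℂ) ∞ L)
    (hslant : IsSlant θ L) (hq : q ∈ I ×ˢ K) :
    metric (cplxJ (fderiv ℝ (L ∘ φ) q (1, 0))) (fderiv ℝ (L ∘ φ) q (0, 1)) ^ 2 =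
      Real.sinh θ ^ 2 :=
  (hslant.isSlantPlane_tangentPlaneAt (φ q)).metric_cplxJ_sq
    (h.range_fderiv hL hq ▸ ⟨_, rfl⟩) (h.range_fderiv hL hq ▸ ⟨_, rfl⟩) (h.isNullPair hq)

end IsNullRectangle

end NullRectangle

/-! ### Congruence with the model surfaces -/

theorem eq_zero_of_forall_metric_eq_zero {z : ℂ × ℂ} (h : ∀ w, metric z w = 0) : z = 0 := by
  have hre₁ := h (1, 0)
  have him₁ := h (Complex.I, 0)
  have hre₂ := h (0, 1)
  have him₂ := h (0, Complex.I)
  simp only [metric_eq_re_im, Complex.one_re, Complex.one_im, Complex.zero_re, Complex.zero_im,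
    Complex.I_re, Complex.I_im, mul_zero, mul_one, add_zero, zero_add, neg_zero,
    neg_eq_zero] at hre₁ him₁ hre₂ him₂
  exact Prod.ext (Complex.ext hre₁ him₁) (Complex.ext hre₂ him₂)

theorem normSq_fst_ne_zero {a : ℂ × ℂ} (ha : metric a a = 0) (ha0 : a ≠ 0) :
    a.1.re ^ 2 + a.1.im ^ 2 ≠ 0 := fun h => ha0 <| by
  rw [metric_eq_re_im] at ha
  have hre₁ : a.1.re = 0 := by nlinarith
  have him₁ : a.1.im = 0 := by nlinarith
  have hre₂ : a.2.re = 0 := by nlinarith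
  have him₂ : a.2.im = 0 := by nlinarith
  exact Prod.ext (Complex.ext hre₁ him₁) (Complex.ext hre₂ him₂)

theorem exists_isometry_one_one {a : ℂ × ℂ} (ha : metric a a = 0) (ha0 : a ≠ 0) :
    ∃ Λ : (ℂ × ℂ) ≃ₗ[ℂ] ℂ × ℂ, Λ (1, 1) = a ∧ ∀ z w, metric (Λ z) (Λ w) = metric z w := by
  -- `diag(a₁, a₂)` scales the metric by `|a₁|² = |a₂|²`; the boost with rows `(p, m)`, `(m, p)`
  -- fixes `(1, 1)` and scales it by `p² - m²`, the inverse factor.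
  obtain ⟨p, m, hpm, hscale⟩ : ∃ p m : ℝ, p + m = 1 ∧
      (p ^ 2 - m ^ 2) * (a.1.re ^ 2 + a.1.im ^ 2) = 1 := by
    have hne := normSq_fst_ne_zero ha ha0
    refine ⟨(1 + (a.1.re ^ 2 + a.1.im ^ 2)⁻¹) / 2, (1 - (a.1.re ^ 2 + a.1.im ^ 2)⁻¹) / 2,
      by ring, ?_⟩
    field_simp
    ring
  rw [metric_eq_re_im] at ha
  let Λ : (ℂ × ℂ) →ₗ[ℂ] ℂ × ℂ :=
    (a.1 • ((p : ℂ) • LinearMap.fst ℂ ℂ ℂ + (m : ℂ) • LinearMap.snd ℂ ℂ ℂ)).prod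
      (a.2 • ((m : ℂ) • LinearMap.fst ℂ ℂ ℂ + (p : ℂ) • LinearMap.snd ℂ ℂ ℂ))
  have hΛ_apply : ∀ z, Λ z = (a.1 * (p * z.1 + m * z.2), a.2 * (m * z.1 + p * z.2)) :=
    fun _ => rfl
  have hΛ : ∀ z w, metric (Λ z) (Λ w) = metric z w := fun z w => by
    simp only [hΛ_apply, metric_eq_re_im, Complex.mul_re, Complex.mul_im, Complex.add_re,
      Complex.add_im, Complex.ofReal_re, Complex.ofReal_im, zero_mul, sub_zero, add_zero]
    linear_combination (-(z.1.re * w.1.re + z.1.im * w.1.im) +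
      (z.2.re * w.2.re + z.2.im * w.2.im)) * hscale +
      ((m * z.1.re + p * z.2.re) * (m * w.1.re + p * w.2.re) +
        (m * z.1.im + p * z.2.im) * (m * w.1.im + p * w.2.im)) * ha
  have hinj : Function.Injective Λ := (injective_iff_map_eq_zero Λ).2 fun z hz =>
    eq_zero_of_forall_metric_eq_zero fun w => by rw [← hΛ, hz, metric_zero_left]
  refine ⟨LinearEquiv.ofInjectiveEndo Λ hinj, ?_, hΛ⟩
  have hpm' : (p : ℂ) + m = 1 := by exact_mod_cast hpm
  have hmp' : (m : ℂ) + p = 1 := by rw [add_comm, hpm']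
  rw [LinearEquiv.coe_ofInjectiveEndo, hΛ_apply, mul_one, mul_one, hpm', hmp', mul_one, mul_one]

/-- The null vector `∂ψ/∂y` of the surface `ψ(x, y)` belonging to `f = 0`. -/
noncomputable def modelNormal (θ : ℝ) : ℂ × ℂ :=
  ((Real.cosh θ : ℂ) ^ 2 / 2, (Real.cosh θ : ℂ) ^ 2 / 2 - 1 - Complex.I * (Real.sinh θ : ℂ))

theorem model_eq (θ : ℝ) (f : ℝ → ℝ) (q : ℝ × ℝ) :
    model θ f q = q.1 • ((1, 1) : ℂ × ℂ) + (q.2 • modelNormal θ +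
      f q.2 • ((Complex.I - (Real.sinh θ : ℂ)) • ((1, 1) : ℂ × ℂ))) := by
  ext1 <;> simp only [model, modelNormal, Prod.fst_add, Prod.snd_add, Prod.smul_fst, Prod.smul_snd,
    Complex.real_smul, smul_eq_mul] <;> ring

theorem eq_modelNormal_add_smul {θ : ℝ} {m : ℂ × ℂ} (h : IsNullPair (1, 1) m)
    (hJ : metric (cplxJ (1, 1)) m = -Real.sinh θ) :
    m = modelNormal θ + m.1.im • ((Complex.I - (Real.sinh θ : ℂ)) • ((1, 1) : ℂ × ℂ)) := by
  have hcross := h.cross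
  have hnull := h.right
  simp only [cplxJ, metric_eq_re_im, Prod.smul_fst, Prod.smul_snd, smul_eq_mul, Complex.I_re,
    Complex.I_im, Complex.one_re, Complex.one_im, zero_mul, one_mul, mul_one, zero_add,
    add_zero] at hcross hJ hnull
  have hre₂ : m.2.re = m.1.re - 1 := by linarith
  have him₂ : m.2.im = m.1.im - Real.sinh θ := by linarith
  have hre₁ : m.1.re = Real.cosh θ ^ 2 / 2 - Real.sinh θ * m.1.im := by
    rw [hre₂, him₂] at hnull
    linear_combination -hnull / 2 - Real.cosh_sq θ / 2
  have hm₁ : m.1 = (m.1.re : ℂ) + m.1.im * Complex.I := (Complex.re_add_im _).symm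
  have hm₂ : m.2 = (m.2.re : ℂ) + m.2.im * Complex.I := (Complex.re_add_im _).symm
  rw [hre₁] at hm₁
  rw [hre₂, him₂, hre₁] at hm₂
  push_cast [-Complex.ofReal_sinh, -Complex.ofReal_cosh] at hm₁ hm₂
  ext1 <;> simp only [modelNormal, Prod.fst_add, Prod.snd_add, Prod.smul_fst, Prod.smul_snd,
    Complex.real_smul, smul_eq_mul]
  · linear_combination hm₁
  · linear_combination hm₂

theorem IsMotion.trans {Φ Ψ : (ℂ × ℂ) ≃ᵃ[ℝ] (ℂ × ℂ)} (hΦ : IsMotion Φ) (hΨ : IsMotion Ψ) :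
    IsMotion (Φ.trans Ψ) := by
  refine ⟨fun z w => (hΨ.1 _ _).trans (hΦ.1 z w), ?_⟩
  change (∀ z, Ψ.linear (Φ.linear (cplxJ z)) = cplxJ (Ψ.linear (Φ.linear z))) ∨
    ∀ z, Ψ.linear (Φ.linear (cplxJ z)) = -cplxJ (Ψ.linear (Φ.linear z))
  rcases hΦ.2 with hΦ | hΦ <;> rcases hΨ.2 with hΨ | hΨ <;> simp [hΦ, hΨ]

theorem isMotion_linear_trans_constVAdd {Λ : (ℂ × ℂ) ≃ₗ[ℂ] ℂ × ℂ}
    (hΛ : ∀ z w, metric (Λ z) (Λ w) = metric z w) (v : ℂ × ℂ) :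
    IsMotion ((Λ.restrictScalars ℝ).toAffineEquiv.trans (AffineEquiv.constVAdd ℝ _ v)) :=
  ⟨hΛ, Or.inl fun z => Λ.map_smul Complex.I z⟩

theorem metric_star (z w : ℂ × ℂ) : metric (star z) (star w) = metric z w := by
  simp [metric_eq_re_im]

theorem star_cplxJ (z : ℂ × ℂ) : star (cplxJ z) = -cplxJ (star z) := by
  simp [cplxJ, star_smul]

theorem isMotion_star :
    IsMotion (starL' ℝ : (ℂ × ℂ) ≃L[ℝ] ℂ × ℂ).toLinearEquiv.toAffineEquiv :=
  ⟨metric_star, Or.inr star_cplxJ⟩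

theorem congruentToModel_of_star_comp {θ : ℝ} {G : ℝ × ℝ → ℂ × ℂ} {I K : Set ℝ}
    (h : CongruentToModel θ (star ∘ G) I K) : CongruentToModel θ G I K := by
  obtain ⟨f, hf, Φ, hΦ, hG⟩ := h
  refine ⟨f, hf, _, hΦ.trans isMotion_star, fun q hq => ?_⟩
  rw [← star_star (G q)]
  exact congrArg star (hG q hq)

theorem congruentToModel_of_eq_empty {θ : ℝ} {G : ℝ × ℝ → ℂ × ℂ} {I K : Set ℝ}
    (h : I ×ˢ K = ∅) : CongruentToModel θ G I K :=
  ⟨0, contDiffOn_const, AffineEquiv.refl ℝ _, ⟨fun _ _ => rfl, Or.inl fun _ => rfl⟩, fun q hq =>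
    absurd (h ▸ hq) (Set.notMem_empty q)⟩

section Translation

variable {θ s : ℝ} {I K : Set ℝ} {γ : ℝ → ℂ × ℂ} {a : ℂ × ℂ} {G : ℝ × ℝ → ℂ × ℂ}

theorem exists_model_eq (hK : IsOpen K) (hK' : K.OrdConnected) (hγ : ContDiffOn ℝ ∞ γ K)
    (hpair : ∀ y ∈ K, IsNullPair (1, 1) (deriv γ y))
    (hJ : ∀ y ∈ K, metric (cplxJ (1, 1)) (deriv γ y) = -Real.sinh θ) :
    ∃ f : ℝ → ℝ, ContDiffOn ℝ ∞ f K ∧ ∃ b, ∀ x, ∀ y ∈ K,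
      x • ((1, 1) : ℂ × ℂ) + γ y = b + model θ f (x, y) := by
  let imFst : ℂ × ℂ →L[ℝ] ℝ := Complex.imCLM.comp (ContinuousLinearMap.fst ℝ ℂ ℂ)
  let f : ℝ → ℝ := fun y => imFst (γ y)
  let c : ℂ × ℂ := (Complex.I - (Real.sinh θ : ℂ)) • ((1, 1) : ℂ × ℂ)
  have hderiv : ∀ y ∈ K, HasDerivAt (fun y => γ y - (y • modelNormal θ + f y • c)) 0 y := by
    intro y hy
    have hγ' := (differentiableAt_of_contDiffOn hγ hK hy).hasDerivAt
    have hf' : HasDerivAt f (imFst (deriv γ y)) y := imFst.hasFDerivAt.comp_hasDerivAt y hγ'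
    have heq : deriv γ y = modelNormal θ + imFst (deriv γ y) • c :=
      eq_modelNormal_add_smul (hpair y hy) (hJ y hy)
    have hE := hγ'.sub (((hasDerivAt_id y).smul_const (modelNormal θ)).add (hf'.smul_const c))
    rwa [one_smul, ← heq, sub_self] at hE
  obtain ⟨b, hb⟩ := hK.exists_is_const_of_deriv_eq_zero hK'.isPreconnected
    (fun y hy => (hderiv y hy).differentiableAt.differentiableWithinAt)
    (fun y hy => (hderiv y hy).deriv)
  refine ⟨f, imFst.contDiff.comp_contDiffOn hγ, b, fun x y hy => ?_⟩
  rw [model_eq, ← hb y hy]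
  abel

theorem congruentToModel_of_eq_smul_add_neg (hK : IsOpen K) (hK' : K.OrdConnected)
    (hγ : ContDiffOn ℝ ∞ γ K) (hpair : ∀ y ∈ K, IsNullPair a (deriv γ y))
    (hJ : ∀ y ∈ K, metric (cplxJ a) (deriv γ y) = -Real.sinh θ)
    (hG : ∀ q ∈ I ×ˢ K, G q = q.1 • a + γ q.2) : CongruentToModel θ G I K := by
  rcases K.eq_empty_or_nonempty with rfl | ⟨y₀, hy₀⟩
  · exact congruentToModel_of_eq_empty (Set.prod_empty)
  have ha0 : a ≠ 0 := fun h => by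
    simpa [h, metric_zero_left] using (hpair y₀ hy₀).cross
  obtain ⟨Λ, rfl, hΛ⟩ := exists_isometry_one_one (hpair y₀ hy₀).left ha0
  let S : ℂ × ℂ →L[ℝ] ℂ × ℂ :=
    LinearMap.toContinuousLinearMap ((Λ.restrictScalars ℝ).symm : ℂ × ℂ →ₗ[ℝ] ℂ × ℂ)
  have hS : ∀ z, Λ (S z) = z := Λ.apply_symm_apply
  have hmetric : ∀ z w, metric z (S w) = metric (Λ z) w := fun z w => by rw [← hΛ, hS]
  have hderiv : ∀ y ∈ K, deriv (S ∘ γ) y = S (deriv γ y) := fun y hy =>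
    (S.hasFDerivAt.comp_hasDerivAt y
      (differentiableAt_of_contDiffOn hγ hK hy).hasDerivAt).deriv
  obtain ⟨f, hf, b, hfb⟩ := exists_model_eq hK hK' (S.contDiff.comp_contDiffOn hγ)
    (fun y hy => by
      rw [hderiv y hy]
      exact ⟨by rw [← hΛ, (hpair y hy).left], by rw [hmetric, hS, (hpair y hy).right],
        by rw [hmetric, (hpair y hy).cross]⟩)
    (fun y hy => by
      rw [hderiv y hy, hmetric, cplxJ, Λ.map_smul]
      exact hJ y hy)
  refine ⟨f, hf, _, isMotion_linear_trans_constVAdd hΛ (Λ b), fun q hq => ?_⟩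
  calc G q = Λ (q.1 • (1, 1) + (S ∘ γ) q.2) := by
        rw [hG q hq, map_add, Function.comp_apply, hS, LinearMapClass.map_smul_of_tower]
    _ = Λ b + Λ (model θ f q) := by rw [hfb q.1 q.2 hq.2, map_add]

theorem congruentToModel_of_eq_smul_add (hK : IsOpen K) (hK' : K.OrdConnected)
    (hγ : ContDiffOn ℝ ∞ γ K) (hpair : ∀ y ∈ K, IsNullPair a (deriv γ y))
    (hs : s ^ 2 = Real.sinh θ ^ 2) (hJ : ∀ y ∈ K, metric (cplxJ a) (deriv γ y) = s)
    (hG : ∀ q ∈ I ×ˢ K, G q = q.1 • a + γ q.2) : CongruentToModel θ G I K := by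
  rcases sq_eq_sq_iff_eq_or_eq_neg.1 hs with rfl | rfl
  · -- complex conjugation is an isometry that changes the sign of `J`
    have hderiv : ∀ y, deriv (fun y => star (γ y)) y = star (deriv γ y) := fun y => deriv.star
    refine congruentToModel_of_star_comp (congruentToModel_of_eq_smul_add_neg (a := star a) hK hK'
      ((starL' ℝ : (ℂ × ℂ) ≃L[ℝ] ℂ × ℂ).contDiff.comp_contDiffOn hγ) (fun y hy => ?_)
      (fun y hy => ?_) (fun q hq => ?_))
    · refine (hderiv y).symm ▸ ⟨?_, ?_, ?_⟩ <;> rw [metric_star]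
      exacts [(hpair y hy).left, (hpair y hy).right, (hpair y hy).cross]
    · refine (hderiv y).symm ▸ ?_
      rw [← neg_neg (cplxJ (star a)), ← star_cplxJ, metric_neg_left, metric_star, hJ y hy]
    · rw [Function.comp_apply, hG q hq, star_add, star_smul, star_trivial]
      rfl
  · exact congruentToModel_of_eq_smul_add_neg hK hK' hγ hpair hJ hG

theorem congruentToModel_of_fderiv_fst_eq (hI : IsOpen I) (hI' : I.OrdConnected) (hK : IsOpen K)
    (hK' : K.OrdConnected) (hG : ContDiffOn ℝ ∞ G (I ×ˢ K)) (hs : s ^ 2 = Real.sinh θ ^ 2)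
    (ha : ∀ q ∈ I ×ˢ K, fderiv ℝ G q (1, 0) = a)
    (hpair : ∀ q ∈ I ×ˢ K, IsNullPair a (fderiv ℝ G q (0, 1)))
    (hJ : ∀ q ∈ I ×ˢ K, metric (cplxJ a) (fderiv ℝ G q (0, 1)) = s) :
    CongruentToModel θ G I K := by
  rcases I.eq_empty_or_nonempty with rfl | ⟨x₀, hx₀⟩
  · exact congruentToModel_of_eq_empty (Set.empty_prod)
  have hR : IsOpen (I ×ˢ K) := hI.prod hK
  have hmem : ∀ y ∈ K, (x₀, y) ∈ I ×ˢ K := fun y hy => ⟨hx₀, hy⟩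
  have hderiv : ∀ y ∈ K, deriv (fun y => G (x₀, y) - x₀ • a) y = fderiv ℝ G (x₀, y) (0, 1) :=
    fun y hy => (((differentiableAt_of_contDiffOn hG hR (hmem y hy)).hasFDerivAt.comp_hasDerivAt y
      ((hasDerivAt_const y x₀).prodMk (hasDerivAt_id y))).sub_const _).deriv
  refine congruentToModel_of_eq_smul_add (a := a) (γ := fun y => G (x₀, y) - x₀ • a) hK hK'
    ((hG.comp (contDiff_const.prodMk contDiff_id).contDiffOn hmem).sub contDiffOn_const)
    (fun y hy => hderiv y hy ▸ hpair _ (hmem y hy)) hs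
    (fun y hy => hderiv y hy ▸ hJ _ (hmem y hy)) fun q hq => ?_
  have hH : ∀ q ∈ I ×ˢ K, HasFDerivAt (fun q => G q - q.1 • a)
      (fderiv ℝ G q - (ContinuousLinearMap.fst ℝ ℝ ℝ).smulRight a) q := fun q hq =>
    (differentiableAt_of_contDiffOn hG hR hq).hasFDerivAt.sub (hasFDerivAt_fst.smul_const a)
  have hconst := eq_of_fderiv_sub_eq_zero (hI'.convex.prod hK'.convex)
    (fun q hq => (hH q hq).differentiableAt) hq (hmem q.2 hq.2) fun q' hq' => by
      have hdiff : (x₀, q.2) - q = (x₀ - q.1) • ((1, 0) : ℝ × ℝ) := by ext <;> simp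
      rw [(hH q' hq').fderiv, hdiff, map_smul, sub_apply, ha q' hq']
      simp
  simp only at hconst ⊢
  rw [← hconst]
  abel

end Translation

theorem herm_re_im (z w : ℂ × ℂ) : herm z w = metric z w + metric (cplxJ z) w * Complex.I := by
  apply Complex.ext <;> simp [metric, cplxJ, herm, sub_eq_add_neg]

theorem eq_of_herm_eq {a a' b b' : ℂ × ℂ} {κ : ℂ} (hκ : κ ≠ 0) (h₁ : herm a b = κ)
    (h₂ : herm a b' = κ) (h₃ : herm a' b = κ) (h₄ : herm a' b' = κ) (hne : a ≠ a') : b = b' := by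
  simp only [herm] at h₁ h₂ h₃ h₄
  -- `a - a' ≠ 0` is orthogonal to `b` and `b'`, which are therefore proportional over `ℂ`
  have hdet : b.1 * b'.2 = b.2 * b'.1 := by
    by_contra hdet
    refine hne (Prod.ext ((starRingEnd ℂ).injective ?_) ((starRingEnd ℂ).injective ?_)) <;>
      apply mul_left_cancel₀ (sub_ne_zero.2 hdet)
    · linear_combination (h₃ - h₁) * b'.2 - (h₄ - h₂) * b.2
    · linear_combination (h₃ - h₁) * b'.1 - (h₄ - h₂) * b.1
  ext1 <;> apply mul_left_cancel₀ hκ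
  · linear_combination -b.1 * h₂ + b'.1 * h₁ + starRingEnd ℂ a.2 * hdet
  · linear_combination -b.2 * h₂ + b'.2 * h₁ + starRingEnd ℂ a.1 * hdet

section NullRectangle

variable {M : Type*} [TopologicalSpace M] [ChartedSpace E2 M] [IsManifold (𝓡 2) ∞ M]
  {L : M → ℂ × ℂ} {θ : ℝ} {I K : Set ℝ} {φ : ℝ × ℝ → M} {q q' : ℝ × ℝ}

namespace IsNullRectangle

theorem fderiv_fst_eq (h : IsNullRectangle L I K φ) (hL : ContMDiff (𝓡 2) 𝓘(ℝ, ℂ × ℂ) ∞ L)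
    (hmin : IsMinimal L) (hq : q ∈ I ×ˢ K) (hq' : q' ∈ I ×ˢ K) (hfst : q.1 = q'.1) :
    fderiv ℝ (L ∘ φ) q (1, 0) = fderiv ℝ (L ∘ φ) q' (1, 0) := by
  have hX : ∀ x ∈ I ×ˢ K, HasFDerivAt (fun x => fderiv ℝ (L ∘ φ) x (1, 0))
      ((fderiv ℝ (fderiv ℝ (L ∘ φ)) x).flip (1, 0)) x := fun x hx => by
    simpa using (differentiableAt_fderiv (h.contDiffOn hL) h.isOpen hx).hasFDerivAt.clm_apply
      (hasFDerivAt_const ((1, 0) : ℝ × ℝ) x)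
  refine eq_of_fderiv_sub_eq_zero h.convex (fun x hx => (hX x hx).differentiableAt) hq hq'
    fun x hx => ?_
  have hdiff : q' - q = (q'.2 - q.2) • ((0, 1) : ℝ × ℝ) := by ext <;> simp [hfst]
  rw [(hX x hx).fderiv, hdiff, map_smul, ContinuousLinearMap.flip_apply,
    fderiv_fderiv_comm (h.contDiffOn hL) h.isOpen hx,
    h.fderiv_fderiv_eq_zero_of_isMinimal hL hmin hx, smul_zero]

theorem fderiv_snd_eq (h : IsNullRectangle L I K φ) (hL : ContMDiff (𝓡 2) 𝓘(ℝ, ℂ × ℂ) ∞ L)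
    (hmin : IsMinimal L) (hq : q ∈ I ×ˢ K) (hq' : q' ∈ I ×ˢ K) (hsnd : q.2 = q'.2) :
    fderiv ℝ (L ∘ φ) q (0, 1) = fderiv ℝ (L ∘ φ) q' (0, 1) := by
  have hswap := h.swap.fderiv_fst_eq hL hmin (q := q.swap) (q' := q'.swap)
    ⟨hq.2, hq.1⟩ ⟨hq'.2, hq'.1⟩ hsnd
  rwa [← Function.comp_assoc, fderiv_comp_swap, fderiv_comp_swap, Prod.swap_swap, Prod.swap_swap]
    at hswap

theorem exists_metric_cplxJ_eq (h : IsNullRectangle L I K φ)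
    (hL : ContMDiff (𝓡 2) 𝓘(ℝ, ℂ × ℂ) ∞ L) (hslant : IsSlant θ L) :
    ∃ s : ℝ, s ^ 2 = Real.sinh θ ^ 2 ∧ ∀ q ∈ I ×ˢ K,
      metric (cplxJ (fderiv ℝ (L ∘ φ) q (1, 0))) (fderiv ℝ (L ∘ φ) q (0, 1)) = s := by
  rcases (I ×ˢ K).eq_empty_or_nonempty with hempty | ⟨q₀, hq₀⟩
  · exact ⟨_, rfl, fun q hq => absurd (hempty ▸ hq) (Set.notMem_empty q)⟩
  have hd := contDiffOn_fderiv (h.contDiffOn hL) h.isOpen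
  have hX : ContDiffOn ℝ ∞ (fun q => cplxJ (fderiv ℝ (L ∘ φ) q (1, 0))) (I ×ˢ K) :=
    (hd.clm_apply contDiffOn_const).const_smul Complex.I
  have hcont := (contDiffOn_metric hX (hd.clm_apply (contDiffOn_const (c := (0, 1))))).continuousOn
  have hmaps : Set.MapsTo
      (fun q => metric (cplxJ (fderiv ℝ (L ∘ φ) q (1, 0))) (fderiv ℝ (L ∘ φ) q (0, 1)))
      (I ×ˢ K) {Real.sinh θ, -Real.sinh θ} := fun q hq =>
    sq_eq_sq_iff_eq_or_eq_neg.1 (h.metric_cplxJ_sq hL hslant hq)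
  exact ⟨_, h.metric_cplxJ_sq hL hslant hq₀, fun q hq => h.convex.isPreconnected.constant_of_mapsTo
    (Set.toFinite _).isDiscrete hcont hmaps hq hq₀⟩

theorem fderiv_fst_const_or_fderiv_snd_const (h : IsNullRectangle L I K φ)
    (hL : ContMDiff (𝓡 2) 𝓘(ℝ, ℂ × ℂ) ∞ L) (hmin : IsMinimal L) (hslant : IsSlant θ L) :
    (∃ a, ∀ q ∈ I ×ˢ K, fderiv ℝ (L ∘ φ) q (1, 0) = a) ∨
      ∃ b, ∀ q ∈ I ×ˢ K, fderiv ℝ (L ∘ φ) q (0, 1) = b := by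
  rcases (I ×ˢ K).eq_empty_or_nonempty with hempty | ⟨q₀, hq₀⟩
  · exact Or.inl ⟨0, fun q hq => absurd (hempty ▸ hq) (Set.notMem_empty q)⟩
  by_cases hconst : ∀ q ∈ I ×ˢ K, fderiv ℝ (L ∘ φ) q (1, 0) = fderiv ℝ (L ∘ φ) q₀ (1, 0)
  · exact Or.inl ⟨_, hconst⟩
  push Not at hconst
  obtain ⟨q₁, hq₁, hne⟩ := hconst
  obtain ⟨s, -, hs⟩ := h.exists_metric_cplxJ_eq hL hslant
  have hherm : ∀ x ∈ I ×ˢ K, ∀ y ∈ I ×ˢ K,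
      herm (fderiv ℝ (L ∘ φ) x (1, 0)) (fderiv ℝ (L ∘ φ) y (0, 1)) = -1 + s * Complex.I := by
    intro x hx y hy
    have hxy : (x.1, y.2) ∈ I ×ˢ K := ⟨hx.1, hy.2⟩
    rw [h.fderiv_fst_eq hL hmin hx hxy rfl, h.fderiv_snd_eq hL hmin hy hxy rfl, herm_re_im,
      (h.isNullPair hxy).cross, hs _ hxy]
    norm_num
  have hκ : (-1 : ℂ) + s * Complex.I ≠ 0 := fun h0 => by simpa using congrArg Complex.re h0
  exact Or.inr ⟨_, fun q hq => eq_of_herm_eq hκ (hherm q₁ hq₁ q hq) (hherm q₁ hq₁ q₀ hq₀)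
    (hherm q₀ hq₀ q hq) (hherm q₀ hq₀ q₀ hq₀) hne⟩

theorem congruentToModel_of_fderiv_fst_eq (h : IsNullRectangle L I K φ)
    (hL : ContMDiff (𝓡 2) 𝓘(ℝ, ℂ × ℂ) ∞ L) (hslant : IsSlant θ L) {a : ℂ × ℂ}
    (ha : ∀ q ∈ I ×ˢ K, fderiv ℝ (L ∘ φ) q (1, 0) = a) : CongruentToModel θ (L ∘ φ) I K := by
  obtain ⟨s, hs, hJ⟩ := h.exists_metric_cplxJ_eq hL hslant
  exact LorentzianC2.congruentToModel_of_fderiv_fst_eq h.open_left h.interval_left h.open_right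
    h.interval_right (h.contDiffOn hL) hs ha (fun q hq => ha q hq ▸ h.isNullPair hq)
    fun q hq => ha q hq ▸ hJ q hq

theorem congruentToModel (h : IsNullRectangle L I K φ)
    (hL : ContMDiff (𝓡 2) 𝓘(ℝ, ℂ × ℂ) ∞ L) (hmin : IsMinimal L) (hslant : IsSlant θ L) :
    CongruentToModel θ (L ∘ φ) I K ∨ CongruentToModel θ ((L ∘ φ) ∘ Prod.swap) K I := by
  rcases h.fderiv_fst_const_or_fderiv_snd_const hL hmin hslant with ⟨a, ha⟩ | ⟨b, hb⟩
  · exact Or.inl (h.congruentToModel_of_fderiv_fst_eq hL hslant ha)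
  · refine Or.inr (h.swap.congruentToModel_of_fderiv_fst_eq hL hslant (a := b) fun q hq => ?_)
    rw [← Function.comp_assoc, fderiv_comp_swap]
    exact hb q.swap ⟨hq.2, hq.1⟩

end IsNullRectangle

end NullRectangle

/-! ### Totally geodesic surfaces -/

section TotallyGeodesic

variable {M : Type*} [TopologicalSpace M] [ChartedSpace E2 M] {L : M → ℂ × ℂ} {θ : ℝ}

/-- The affine tangent plane of the surface `L` at `p`, as a plane through `L p` in `ℂ²₁`. -/
noncomputable def affineTangentPlaneAt (L : M → ℂ × ℂ) (p : M) : AffineSubspace ℝ (ℂ × ℂ) :=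
  AffineSubspace.mk' (L p) (tangentPlaneAt L p)

variable [IsManifold (𝓡 2) ∞ M]

theorem IsNullRectangle.exists_eq_add_of_isTotallyGeodesic {I K : Set ℝ} {φ : ℝ × ℝ → M}
    (h : IsNullRectangle L I K φ) (hL : ContMDiff (𝓡 2) 𝓘(ℝ, ℂ × ℂ) ∞ L)
    (hgeo : IsTotallyGeodesic L) : ∃ (b : ℂ × ℂ) (T : ℝ × ℝ →L[ℝ] ℂ × ℂ), ∀ q ∈ I ×ˢ K,
      fderiv ℝ (L ∘ φ) q = T ∧ L (φ q) = b + T q := by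
  have hG := h.contDiffOn hL
  obtain ⟨T, hT⟩ := h.isOpen.exists_is_const_of_fderiv_eq_zero h.convex.isPreconnected
    (fun q hq => (differentiableAt_fderiv hG h.isOpen hq).differentiableWithinAt)
    fun q hq => h.fderiv_fderiv_eq_zero_of_isTotallyGeodesic hL hgeo hq
  have hsub : ∀ q ∈ I ×ˢ K, HasFDerivAt (fun q => L (φ q) - T q) 0 q := fun q hq => by
    rw [← sub_self T]
    nth_rewrite 2 [← hT q hq]
    exact (differentiableAt_of_contDiffOn hG h.isOpen hq).hasFDerivAt.sub T.hasFDerivAt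
  obtain ⟨b, hb⟩ := h.isOpen.exists_is_const_of_fderiv_eq_zero h.convex.isPreconnected
    (fun q hq => (hsub q hq).differentiableAt.differentiableWithinAt)
    fun q hq => (hsub q hq).fderiv
  exact ⟨b, T, fun q hq => ⟨hT q hq, sub_eq_iff_eq_add.1 (hb q hq)⟩⟩

theorem exists_isOpen_image_eq_affineTangentPlaneAt_inter
    (hL : ContMDiff (𝓡 2) 𝓘(ℝ, ℂ × ℂ) ∞ L) (hflat : IsFlat L) (hslant : IsSlant θ L)
    (hgeo : IsTotallyGeodesic L) (p : M) : ∃ N : Set M, IsOpen N ∧ p ∈ N ∧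
      (∀ p' ∈ N, affineTangentPlaneAt L p' = affineTangentPlaneAt L p) ∧
      ∃ O : Set (ℂ × ℂ), IsOpen O ∧ L '' N = (affineTangentPlaneAt L p : Set (ℂ × ℂ)) ∩ O := by
  obtain ⟨I, K, φ, h, -, ⟨q₀, hq₀, rfl⟩, hopen⟩ := exists_isNullRectangle hL hflat hslant p
  obtain ⟨b, T, hT⟩ := h.exists_eq_add_of_isTotallyGeodesic hL hgeo
  have hplane : ∀ q ∈ I ×ˢ K,
      (affineTangentPlaneAt L (φ q) : Set (ℂ × ℂ)) = Set.range fun v => b + T v := fun q hq => by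
    ext z
    rw [affineTangentPlaneAt, ← h.range_fderiv hL hq, (hT q hq).1, (hT q hq).2, SetLike.mem_coe,
      AffineSubspace.mem_mk', vsub_eq_sub]
    constructor
    · rintro ⟨v, hv⟩
      refine ⟨v + q, ?_⟩
      simp only [ContinuousLinearMap.coe_coe] at hv
      simp only [map_add, hv]
      abel
    · rintro ⟨v, rfl⟩
      exact ⟨v - q, by simp⟩
  have hinj : Function.Injective (T : ℝ × ℝ →ₗ[ℝ] ℂ × ℂ) :=
    (hT q₀ hq₀).1 ▸ IsNullPair.injective (T := (fderiv ℝ (L ∘ φ) q₀ : ℝ × ℝ →ₗ[ℝ] ℂ × ℂ))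
      (h.isNullPair hq₀) (by simp)
  have hind : Topology.IsInducing fun v => b + T v :=
    (Homeomorph.addLeft b).isInducing.comp
      (LinearMap.isClosedEmbedding_of_injective (LinearMap.ker_eq_bot.2 hinj)).isInducing
  obtain ⟨O, hO, hpre⟩ := hind.isOpen_iff.1 h.isOpen
  refine ⟨φ '' (I ×ˢ K), hopen, ⟨q₀, hq₀, rfl⟩, ?_, O, hO, ?_⟩
  · rintro _ ⟨q, hq, rfl⟩
    exact SetLike.coe_injective ((hplane q hq).trans (hplane q₀ hq₀).symm)
  · rw [hplane q₀ hq₀, ← Set.image_preimage_eq_range_inter, hpre, Set.image_image]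
    exact Set.image_congr fun q hq => (hT q hq).2

theorem isOpenPieceOfSlantPlane [ConnectedSpace M] (hL : ContMDiff (𝓡 2) 𝓘(ℝ, ℂ × ℂ) ∞ L)
    (hflat : IsFlat L) (hslant : IsSlant θ L) (hgeo : IsTotallyGeodesic L) :
    IsOpenPieceOfSlantPlane θ L := by
  choose N hN hpN hconst O hO himage using
    exists_isOpen_image_eq_affineTangentPlaneAt_inter hL hflat hslant hgeo
  have hloc : IsLocallyConstant (affineTangentPlaneAt L) :=
    (IsLocallyConstant.iff_exists_open _).2 fun p => ⟨N p, hN p, hpN p, hconst p⟩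
  obtain ⟨p₀⟩ : Nonempty M := inferInstance
  refine ⟨affineTangentPlaneAt L p₀, ?_, ⋃ p, O p, isOpen_iUnion hO, ?_⟩
  · rw [affineTangentPlaneAt, AffineSubspace.direction_mk']
    exact hslant.isSlantPlane_tangentPlaneAt p₀
  · calc Set.range L = ⋃ p, L '' N p := by
          rw [← Set.image_univ, ← Set.iUnion_eq_univ_iff.2 fun p => ⟨p, hpN p⟩, Set.image_iUnion]
      _ = ⋃ p, (affineTangentPlaneAt L p₀ : Set (ℂ × ℂ)) ∩ O p := Set.iUnion_congr fun p => by
          rw [himage, hloc.apply_eq_of_preconnectedSpace p p₀]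
      _ = _ := (Set.inter_iUnion _ _).symm

end TotallyGeodesic

end LorentzianC2

open LorentzianC2 in
theorem corollary5p1 {M : Type*} [TopologicalSpace M] [ChartedSpace E2 M]
    [IsManifold (𝓡 2) ∞ M] [ConnectedSpace M] (θ : ℝ) (L : M → ℂ × ℂ)
    (hL : IsLorentzianSurface L) (hmin : IsMinimal L) (hflat : IsFlat L)
    (hslant : IsSlant θ L) :
    IsOpenPieceOfSlantPlane θ L ∨
      (¬ IsTotallyGeodesic L ∧
        (∀ p : M, ∃ (I K : Set ℝ) (φ : ℝ × ℝ → M),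
          IsNullRectangle L I K φ ∧ Set.InjOn φ (I ×ˢ K) ∧ p ∈ φ '' (I ×ˢ K) ∧
            CongruentToModel θ (L ∘ φ) I K) ∧
        (∀ (I K : Set ℝ) (φ : ℝ × ℝ → M), IsNullRectangle L I K φ →
          CongruentToModel θ (L ∘ φ) I K ∨
            CongruentToModel θ ((L ∘ φ) ∘ Prod.swap) K I)) := by
  by_cases hgeo : IsTotallyGeodesic L
  · exact Or.inl (isOpenPieceOfSlantPlane hL.smooth hflat hslant hgeo)
  refine Or.inr ⟨hgeo, fun p => ?_, fun I K φ h => h.congruentToModel hL.smooth hmin hslant⟩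
  obtain ⟨I, K, φ, h, hinj, hp, -⟩ := exists_isNullRectangle hL.smooth hflat hslant p
  rcases h.congruentToModel hL.smooth hmin hslant with hφ | hswap
  · exact ⟨I, K, φ, h, hinj, hp, hφ⟩
  · refine ⟨K, I, φ ∘ Prod.swap, h.swap, ?_, ?_, hswap⟩
    · exact hinj.comp Prod.swap_injective.injOn fun q hq => ⟨hq.2, hq.1⟩
    · obtain ⟨q, hq, rfl⟩ := hp
      exact ⟨q.swap, ⟨hq.2, hq.1⟩, by simp⟩
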